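/- Let $\alpha>0$, $C>0$ and $\sigma>0$. For a function $h:\mathbb R\to\mathbb R$ write $h\in\text{Hölder}^{\alpha}(C)$ if $h$ is $k$ times differentiable and $|h^{(k)}(t)-h^{(k)}(t')|\le C|t-t'|^{\alpha-k}$ for all $t,t'\in\mathbb R$, where $k=\lfloor\alpha\rfloor$ is the integer part of $\alpha$. Let $f_h(t_1,t_2)=\mathbf 1_{\{t_2<h(t_1)\}}$ on $[0,1]^2$, and let the Horizon class be $$H^\alpha(C)=\{f_h : h\in \text{Hölder}^{\alpha}(C)\cap\text{Hölder}^{1}(1)\}.$$ For $n\ge 1$ and $0\le i,j\le n-1$ let $x_{i,j}$ be the average of $f$ over the pixel $[\frac in,\frac{i+1}n)\times[\frac jn,\frac{j+1}n)$, and observe $y_{i,j}=x_{i,j}+z_{i,j}$, where the $z_{i,j}$ are i.i.d. $N(0,\sigma^2)$. For $\tau>0$ and an integer $\Delta\ge 0$ the semi-oracle Yaroslavsky filter (SYF) is $$\hat f^{SY}_{\Delta,\tau}(i,j)=\frac{\sum_{m=i-\Delta}^{i+\Delta}\sum_{\ell=j-\Delta}^{j+\Delta} w_{i,j}(m,\ell)\,y_{m,\ell}}{\sum_{m=i-\Delta}^{i+\Delta}\sum_{\ell=j-\Delta}^{j+\Delta}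 w_{i,j}(m,\ell)},\qquad w_{i,j}(m,\ell)=e^{-(y_{m,\ell}-x_{i,j})^2/(2\tau^2)},$$ where at the image boundary either $y$ is extended periodically or the sums are restricted to the pixels of the image. Its risk is $R_n(f,\hat f^{SY}_{\Delta,\tau})=\mathbb E\big(\frac1{n^2}\sum_{i,j}(x_{i,j}-\hat f^{SY}_{\Delta,\tau}(i,j))^2\big)$. Let the range $T\subset(0,\infty)$ of the parameter $\tau$ be any fixed (independent of $n$) nonempty set that is bounded away from $0$; for instance $T=\{\tau\}$ for a fixed $\tau>0$, or $T=[\tau_0,\infty)$. Then $$\inf_{\tau\in T,\ \Delta\ge 0}\ \sup_{f\in H^\alpha(C)} R_n(f,\hat f^{SY}_{\Delta,\tau})\asymp n^{-2/3},$$ that is, there are constants $c_1,c_2>0$ and $n_0$, depending only on $\alpha,C,\sigma,T$, such that the left side lies between $c_1n^{-2/3}$ and $c_2n^{-2/3}$ for all $n>n_0$. This holds for either boundary convention, and whether, at integers $a$, $\lfloor a\rfloor$ is read as $a$ or as the largest integer strictly less than $a$ (so that $\text{Hölder}^1(1)$ consists of the $1$-Lipschitz functions). -/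

import Mathlib

open MeasureTheory ProbabilityTheory
open scoped ENNReal NNReal

noncomputable section

namespace HorizonDenoising

/-- The two readings of the integer part used as the order of differentiation in the Hölder
condition; they differ only at integers. -/
inductive IntegerPart
  | floor
  | strict

/-- `floor`: the largest integer `≤ a`.  `strict`: the largest integer `< a` (for `a > 0`), so that
the Hölder class of order `1` is a class of Lipschitz functions. -/
def IntegerPart.eval : IntegerPart → ℝ → ℕ
  | .floor, a => ⌊a⌋₊
  | .strict, a => ⌈a⌉₊ - 1

/-- `h` belongs to `Hölder^α(C)`: it is `k` times differentiable on `ℝ`, where `k` is the integer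
part of `α`, and `|h^(k)(t) - h^(k)(t')| ≤ C |t - t'|^(α - k)`. -/
def IsHolder (ip : IntegerPart) (α C : ℝ) (h : ℝ → ℝ) : Prop :=
  (∀ m < ip.eval α, Differentiable ℝ (iteratedDeriv m h)) ∧
    ∀ t t' : ℝ, |iteratedDeriv (ip.eval α) h t - iteratedDeriv (ip.eval α) h t'| ≤
      C * |t - t'| ^ (α - (ip.eval α : ℝ))

/-- The image `f_h(t₁, t₂) = 1_{t₂ < h(t₁)}` (only its values on the unit square are ever used). -/
def horizonImage (h : ℝ → ℝ) : ℝ × ℝ → ℝ :=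
  Set.indicator {t : ℝ × ℝ | t.2 < h t.1} (fun _ => 1)

/-- The Horizon class `H^α(C)`. -/
def horizonClass (ip : IntegerPart) (α C : ℝ) : Set (ℝ × ℝ → ℝ) :=
  {f | ∃ h : ℝ → ℝ, IsHolder ip α C h ∧ IsHolder ip 1 1 h ∧ f = horizonImage h}

/-- The pixel `[i/n, (i+1)/n) × [j/n, (j+1)/n)`, for `0 ≤ i, j ≤ n - 1`. -/
def pixel (n : ℕ) (p : Fin n × Fin n) : Set (ℝ × ℝ) :=
  Set.Ico ((p.1 : ℝ) / n) (((p.1 : ℝ) + 1) / n) ×ˢ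
    Set.Ico ((p.2 : ℝ) / n) (((p.2 : ℝ) + 1) / n)

/-- The noise-free pixel values: `x_{i,j}` is the average of `f` over the pixel `(i, j)`. -/
def pixelMean (n : ℕ) (f : ℝ × ℝ → ℝ) (p : Fin n × Fin n) : ℝ :=
  ⨍ t in pixel n p, f t

/-- The law of the noise: i.i.d. `N(0, σ²)` variables, one for each pixel. -/
def noise (n : ℕ) (σ : ℝ≥0) : Measure (Fin n × Fin n → ℝ) :=
  Measure.pi fun _ => gaussianReal 0 (σ ^ 2)

/-- The risk `E (n⁻² ∑ (x_{i,j} - est_{i,j}(y))²)` of an estimator at `f`, where `y = x + z`. -/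
def risk (n : ℕ) (σ : ℝ≥0) (f : ℝ × ℝ → ℝ)
    (est : (Fin n × Fin n → ℝ) → Fin n × Fin n → ℝ) : ℝ≥0∞ :=
  ∫⁻ z, ENNReal.ofReal
    (1 / (n : ℝ) ^ 2 * ∑ p, (pixelMean n f p - est (pixelMean n f + z) p) ^ 2) ∂(noise n σ)

/-- What happens to neighbourhoods that leave the image: either the image is extended
periodically, or the neighbourhood is intersected with the image. -/
inductive Boundary
  | periodic
  | truncated

/-- The coordinate `i + d` modulo `n`. -/
def shift {n : ℕ} (i : Fin n) (d : ℤ) : Fin n :=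
  ⟨(((i : ℤ) + d) % (n : ℤ)).toNat, by
    have hn : (0 : ℤ) < n := by exact_mod_cast i.pos
    have h0 := Int.emod_nonneg ((i : ℤ) + d) hn.ne'
    have h1 := Int.emod_lt_of_pos ((i : ℤ) + d) hn
    omega⟩

/-- The `Δ`-neighbourhood of the pixel `p`, as the set of the displacements `(m, ℓ) - p` of its
members. -/
def window {n : ℕ} (b : Boundary) (Δ : ℕ) (p : Fin n × Fin n) : Finset (ℤ × ℤ) :=
  match b with
  | .periodic => Finset.Icc (-(Δ : ℤ)) Δ ×ˢ Finset.Icc (-(Δ : ℤ)) Δ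
  | .truncated =>
      (Finset.Icc (-(Δ : ℤ)) Δ ×ˢ Finset.Icc (-(Δ : ℤ)) Δ).filter fun d =>
        (0 ≤ (p.1 : ℤ) + d.1 ∧ (p.1 : ℤ) + d.1 < n) ∧ (0 ≤ (p.2 : ℤ) + d.2 ∧ (p.2 : ℤ) + d.2 < n)

/-- The semi-oracle weight `exp (-(y_{m,ℓ} - x_{i,j})² / (2τ²))`. -/
def semiOracleWeight (τ xp yq : ℝ) : ℝ :=
  Real.exp (-(yq - xp) ^ 2 / (2 * τ ^ 2))

/-- The semi-oracle Yaroslavsky filter with parameters `Δ` and `τ`. It knows the noise-free value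
`x p` of the pixel `p` that it estimates from the noisy image `y`. -/
def semiOracleYF {n : ℕ} (b : Boundary) (Δ : ℕ) (τ : ℝ) (x y : Fin n × Fin n → ℝ)
    (p : Fin n × Fin n) : ℝ :=
  (∑ d ∈ window b Δ p,
      semiOracleWeight τ (x p) (y (shift p.1 d.1, shift p.2 d.2)) *
        y (shift p.1 d.1, shift p.2 d.2)) /
    ∑ d ∈ window b Δ p, semiOracleWeight τ (x p) (y (shift p.1 d.1, shift p.2 d.2))

/-- `u(n) ≍ g(n)` as `n → ∞`. -/
def SameOrder (u : ℕ → ℝ≥0∞) (g : ℕ → ℝ) : Prop :=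
  ∃ c₁ c₂ : ℝ, 0 < c₁ ∧ 0 < c₂ ∧ ∃ n₀ : ℕ, ∀ n > n₀,
    ENNReal.ofReal (c₁ * g n) ≤ u n ∧ u n ≤ ENNReal.ofReal (c₂ * g n)

end HorizonDenoising

end

/-!
Relative to the noise-free value of the pixel that it estimates, the output of the filter is a
weighted mean of the deviations `u` of the pixels in the window, and its numerator is the sum of the
influences `u * exp (-u ^ 2 / (2 * τ ^ 2))`. On a flat image the deviations are pure noise, the
influences are centred, and the mean squared error is of order `1 / Δ ^ 2`: from below because the
weights are at most `1`, from above because the sum of the weights is at least `|D|` times their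
geometric mean.

A horizon `h` for which `h + L * id` is monotone meets each line of slope `-(L + 1)` only once, so
it crosses the windows of only `O(Δ n)` pixels; on these, and on those near the boundary, the mean
squared error is still bounded. The risk is thus `O(1 / Δ ^ 2 + Δ / n)`. Conversely, just above a
horizontal edge a fixed fraction of the window lies below the edge and biases the filter by a
constant, which costs `Δ / n`. The two terms balance at `Δ = n ^ (1 / 3)`.
-/

namespace HorizonDenoising

section Influence

/-- The Gaussian weight with bandwidth `τ` of a deviation `u` from the oracle value. -/
noncomputable def weight (τ u : ℝ) : ℝ := Real.exp (-u ^ 2 / (2 * τ ^ 2))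

/-- A deviation times its weight: the influence function of Welsch's M-estimator of location. -/
noncomputable def influence (τ u : ℝ) : ℝ := weight τ u * u

lemma weight_pos (τ u : ℝ) : 0 < weight τ u := Real.exp_pos _

lemma weight_le_one (τ u : ℝ) : weight τ u ≤ 1 :=
  Real.exp_le_one_iff.2 <|
    div_nonpos_of_nonpos_of_nonneg (neg_nonpos.2 (sq_nonneg u)) (by positivity)

lemma weight_mono {τ₀ τ : ℝ} (hτ₀ : 0 < τ₀) (hτ : τ₀ ≤ τ) (u : ℝ) : weight τ₀ u ≤ weight τ u := by
  rw [weight, weight, Real.exp_le_exp, neg_div, neg_div, neg_le_neg_iff]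
  gcongr

lemma weight_le_weight_of_sq_le_sq (τ : ℝ) {u v : ℝ} (h : u ^ 2 ≤ v ^ 2) :
    weight τ v ≤ weight τ u := by
  rw [weight, weight, Real.exp_le_exp]
  gcongr

lemma sq_weight (τ u : ℝ) : weight τ u ^ 2 = Real.exp (-(u / τ) ^ 2) := by
  rw [weight, ← Real.exp_nat_mul]
  congr 1
  rw [div_pow]
  push_cast
  ring

@[fun_prop]
lemma continuous_weight (τ : ℝ) : Continuous (weight τ) := by
  unfold weight; fun_prop

@[fun_prop]
lemma continuous_influence (τ : ℝ) : Continuous (influence τ) := by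
  unfold influence; fun_prop

lemma influence_neg (τ u : ℝ) : influence τ (-u) = -influence τ u := by
  simp [influence, weight]

lemma sq_influence_le_sq (τ u : ℝ) : influence τ u ^ 2 ≤ u ^ 2 := by
  rw [influence, mul_pow]
  exact mul_le_of_le_one_left (sq_nonneg u)
    (pow_le_one₀ (weight_pos τ u).le (weight_le_one τ u))

lemma sq_influence_mono {τ₀ τ : ℝ} (hτ₀ : 0 < τ₀) (hτ : τ₀ ≤ τ) (u : ℝ) :
    influence τ₀ u ^ 2 ≤ influence τ u ^ 2 := by
  simp only [influence, mul_pow]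
  have := weight_mono hτ₀ hτ u
  have := weight_pos τ₀ u
  gcongr

lemma abs_influence_le {τ : ℝ} (hτ : 0 < τ) (u : ℝ) : |influence τ u| ≤ τ := by
  refine abs_le_of_sq_le_sq ?_ hτ.le
  calc influence τ u ^ 2 = (u / τ) ^ 2 * Real.exp (-(u / τ) ^ 2) * τ ^ 2 := by
        rw [influence, mul_pow, sq_weight]
        field_simp
    _ ≤ 1 * τ ^ 2 := by
        gcongr
        exact (Real.mul_exp_neg_le_exp_neg_one _).trans (Real.exp_le_one_iff.2 (by norm_num))
    _ = τ ^ 2 := one_mul _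

lemma sq_influence_mul_exp_le_sq {τ s : ℝ} (hs : s ≤ 1 / τ ^ 2) (u : ℝ) :
    influence τ u ^ 2 * Real.exp (s * u ^ 2) ≤ u ^ 2 := by
  rw [influence, mul_pow, sq_weight, mul_right_comm, ← Real.exp_add]
  refine mul_le_of_le_one_left (sq_nonneg u) (Real.exp_le_one_iff.2 ?_)
  have : s * u ^ 2 ≤ 1 / τ ^ 2 * u ^ 2 := by gcongr
  rw [div_pow]
  linarith [show 1 / τ ^ 2 * u ^ 2 = u ^ 2 / τ ^ 2 by ring]

end Influence

section WeightedMean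

variable {ι : Type*}

/-- The average over `D` of the deviations `u d`, each weighted by `weight τ (u d)`; this is the
error of the filter when `u d` is the deviation of the pixel `d` from the oracle value. -/
noncomputable def weightedMean (τ : ℝ) (D : Finset ι) (u : ι → ℝ) : ℝ :=
  (∑ d ∈ D, influence τ (u d)) / ∑ d ∈ D, weight τ (u d)

lemma sum_weight_le_card (τ : ℝ) (D : Finset ι) (u : ι → ℝ) :
    ∑ d ∈ D, weight τ (u d) ≤ D.card := by
  simpa using Finset.sum_le_card_nsmul D _ 1 fun d _ => weight_le_one τ (u d)

lemma continuous_weightedMean {X : Type*} [TopologicalSpace X] (τ : ℝ) (D : Finset ι)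
    {u : X → ι → ℝ} (hu : ∀ d, Continuous fun x => u x d) :
    Continuous fun x => weightedMean τ D (u x) := by
  rcases D.eq_empty_or_nonempty with rfl | hD
  · simpa [weightedMean] using continuous_const
  · refine Continuous.div
      (continuous_finsetSum _ fun d _ => (continuous_influence τ).comp (hu d))
      (continuous_finsetSum _ fun d _ => (continuous_weight τ).comp (hu d)) fun x => ?_
    exact (Finset.sum_pos (fun d _ => weight_pos τ _) hD).ne'

lemma sq_mean_influence_le_sq_weightedMean (τ : ℝ) (D : Finset ι) (u : ι → ℝ) :
    (∑ d ∈ D, influence τ (u d)) ^ 2 / (D.card : ℝ) ^ 2 ≤ weightedMean τ D u ^ 2 := by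
  rcases D.eq_empty_or_nonempty with rfl | hD
  · simp [weightedMean]
  · have := Finset.sum_pos (fun d _ => weight_pos τ (u d)) hD
    rw [weightedMean, div_pow]
    gcongr
    exact sum_weight_le_card τ D u

/-- Chebyshev's sum inequality: the weights decrease in `|u d|`, so they only reduce the mean
square. -/
lemma sq_weightedMean_le_mean_sq (τ : ℝ) (D : Finset ι) (u : ι → ℝ) :
    weightedMean τ D u ^ 2 ≤ (∑ d ∈ D, u d ^ 2) / D.card := by
  rcases D.eq_empty_or_nonempty with rfl | hD
  · simp [weightedMean]
  have hW : 0 < ∑ d ∈ D, weight τ (u d) := Finset.sum_pos (fun d _ => weight_pos τ (u d)) hD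
  have hcard : (0 : ℝ) < D.card := by exact_mod_cast hD.card_pos
  have cauchy_schwarz : (∑ d ∈ D, influence τ (u d)) ^ 2 ≤
      (∑ d ∈ D, weight τ (u d)) * ∑ d ∈ D, weight τ (u d) * u d ^ 2 :=
    Finset.sum_sq_le_sum_mul_sum_of_sq_le_mul D (fun d _ => (weight_pos τ (u d)).le)
      (fun d _ => mul_nonneg (weight_pos τ (u d)).le (sq_nonneg _))
      fun d _ => by rw [influence]; exact le_of_eq (by ring)
  have chebyshev : (D.card : ℝ) * ∑ d ∈ D, weight τ (u d) * u d ^ 2 ≤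
      (∑ d ∈ D, weight τ (u d)) * ∑ d ∈ D, u d ^ 2 :=
    AntivaryOn.card_mul_sum_le_sum_mul_sum fun i _ j _ hij =>
      weight_le_weight_of_sq_le_sq τ hij.le
  rw [weightedMean, div_pow, div_le_div_iff₀ (by positivity) hcard]
  nlinarith [mul_le_mul_of_nonneg_left chebyshev hW.le]

lemma card_mul_exp_le_sum_weight (τ : ℝ) (D : Finset ι) (u : ι → ℝ) :
    D.card * Real.exp (-(∑ d ∈ D, u d ^ 2) / (2 * τ ^ 2 * D.card)) ≤ ∑ d ∈ D, weight τ (u d) := by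
  rcases D.eq_empty_or_nonempty with rfl | hD
  · simp
  have hcard : (0 : ℝ) < D.card := by exact_mod_cast hD.card_pos
  have jensen := convexOn_exp.map_sum_le (t := D) (w := fun _ => (D.card : ℝ)⁻¹)
    (p := fun d => -u d ^ 2 / (2 * τ ^ 2)) (fun _ _ => by positivity) (by simp [hcard.ne'])
    (fun _ _ => Set.mem_univ _)
  simp only [smul_eq_mul, ← Finset.mul_sum, ← Finset.sum_div, Finset.sum_neg_distrib] at jensen
  calc _ = D.card * Real.exp ((D.card : ℝ)⁻¹ * (-(∑ d ∈ D, u d ^ 2) / (2 * τ ^ 2))) := by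
        congr 2
        rw [inv_mul_eq_div, div_div]
    _ ≤ D.card * ((D.card : ℝ)⁻¹ * ∑ d ∈ D, weight τ (u d)) := by
        gcongr
        exact jensen
    _ = _ := mul_inv_cancel_left₀ hcard.ne' _

lemma sq_weightedMean_le_sq_sum_influence_mul_prod_exp (τ : ℝ) (D : Finset ι) (u : ι → ℝ) :
    weightedMean τ D u ^ 2 ≤ (∑ d ∈ D, influence τ (u d)) ^ 2 *
      (∏ d ∈ D, Real.exp (1 / (τ ^ 2 * D.card) * u d ^ 2)) / (D.card : ℝ) ^ 2 := by
  rcases D.eq_empty_or_nonempty with rfl | hD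
  · simp [weightedMean]
  have : (0 : ℝ) < D.card := by exact_mod_cast hD.card_pos
  have hprod : ∏ d ∈ D, Real.exp (1 / (τ ^ 2 * D.card) * u d ^ 2) =
      (Real.exp (-(∑ d ∈ D, u d ^ 2) / (2 * τ ^ 2 * D.card)) ^ 2)⁻¹ := by
    rw [← Real.exp_sum, ← Real.exp_nat_mul, ← Real.exp_neg, ← Finset.mul_sum]
    congr 1
    push_cast
    ring
  calc weightedMean τ D u ^ 2
      ≤ (∑ d ∈ D, influence τ (u d)) ^ 2 /
          (D.card * Real.exp (-(∑ d ∈ D, u d ^ 2) / (2 * τ ^ 2 * D.card))) ^ 2 := by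
        rw [weightedMean, div_pow]
        gcongr
        exact card_mul_exp_le_sum_weight τ D u
    _ = _ := by
        rw [hprod]
        field_simp

end WeightedMean

section Product

lemma mul_mul_prod_eq_prod_ite {ι X : Type*} [DecidableEq ι] {Q : Finset ι} {a b : ι} (ha : a ∈ Q)
    (hb : b ∈ Q) (ψ e : X → ℝ) (z : ι → X) :
    ψ (z a) * ψ (z b) * ∏ q ∈ Q, e (z q) =
      ∏ q ∈ Q, (if q = a then ψ (z q) else 1) * (if q = b then ψ (z q) else 1) * e (z q) := by
  simp only [Finset.prod_mul_distrib, Finset.prod_ite_eq', ha, hb, if_true]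

lemma sq_sum_mul_eq_sum_sum {κ : Type*} (Q : Finset κ) (f : κ → ℝ) (r : ℝ) :
    (∑ a ∈ Q, f a) ^ 2 * r = ∑ a ∈ Q, ∑ b ∈ Q, f a * f b * r := by
  simp_rw [sq, Finset.sum_mul_sum, Finset.sum_mul]

variable {ι κ X : Type*} [Fintype ι] [MeasurableSpace X] {μ : Measure X} [IsProbabilityMeasure μ]

lemma integral_finset_prod_eval (Q : Finset ι) (f : ι → X → ℝ) :
    ∫ z : ι → X, ∏ q ∈ Q, f q (z q) ∂Measure.pi (fun _ => μ) = ∏ q ∈ Q, ∫ u, f q u ∂μ := by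
  classical
  have h := integral_fintype_prod_eq_prod (μ := fun _ : ι => μ) (𝕜 := ℝ)
    fun q u => if q ∈ Q then f q u else 1
  have hfactor : ∀ q, ∫ u, (if q ∈ Q then f q u else 1) ∂μ =
      if q ∈ Q then ∫ u, f q u ∂μ else 1 := fun q => by split_ifs <;> simp
  simpa only [hfactor, Finset.prod_ite_mem, Finset.univ_inter] using h

lemma integrable_finset_prod_eval {Q : Finset ι} {f : ι → X → ℝ}
    (hf : ∀ q ∈ Q, Integrable (f q) μ) :
    Integrable (fun z : ι → X => ∏ q ∈ Q, f q (z q)) (Measure.pi fun _ => μ) := by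
  classical
  have h := Integrable.fintype_prod (μ := fun _ : ι => μ)
    (f := fun q u => if q ∈ Q then f q u else 1) fun q => by
      by_cases hq : q ∈ Q
      · simpa [hq] using hf q hq
      · simp [hq]
  simpa only [Finset.prod_ite_mem, Finset.univ_inter] using h

section TiltedSecondMoment

variable {ψ e : X → ℝ}

lemma integrable_mul_mul_prod (he : Integrable e μ) (hψe : Integrable (fun u => ψ u * e u) μ)
    (hψψe : Integrable (fun u => ψ u ^ 2 * e u) μ) {Q : Finset ι} {a b : ι} (ha : a ∈ Q)
    (hb : b ∈ Q) :
    Integrable (fun z : ι → X => ψ (z a) * ψ (z b) * ∏ q ∈ Q, e (z q))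
      (Measure.pi fun _ => μ) := by
  classical
  simp only [mul_mul_prod_eq_prod_ite ha hb]
  refine integrable_finset_prod_eval (f := fun q u =>
    (if q = a then ψ u else 1) * (if q = b then ψ u else 1) * e u) fun q _ => ?_
  rcases eq_or_ne q a with rfl | hqa <;> rcases eq_or_ne q b with rfl | hqb
  · simpa [← sq] using hψψe
  · simpa [hqb] using hψe
  · simpa [hqa] using hψe
  · simpa [hqa, hqb] using he

lemma integral_mul_mul_prod_eq_zero (hψe : ∫ u, ψ u * e u ∂μ = 0) {Q : Finset ι} {a b : ι}
    (ha : a ∈ Q) (hb : b ∈ Q) (hab : a ≠ b) :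
    ∫ z : ι → X, ψ (z a) * ψ (z b) * ∏ q ∈ Q, e (z q) ∂Measure.pi (fun _ => μ) = 0 := by
  classical
  simp only [mul_mul_prod_eq_prod_ite ha hb]
  rw [integral_finset_prod_eval Q fun q u =>
    (if q = a then ψ u else 1) * (if q = b then ψ u else 1) * e u]
  exact Finset.prod_eq_zero ha (by simpa [hab] using hψe)

lemma integral_sq_mul_prod {Q : Finset ι} {a : ι} (ha : a ∈ Q) :
    ∫ z : ι → X, ψ (z a) * ψ (z a) * ∏ q ∈ Q, e (z q) ∂Measure.pi (fun _ => μ) =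
      (∫ u, ψ u ^ 2 * e u ∂μ) * (∫ u, e u ∂μ) ^ (Q.card - 1) := by
  classical
  simp only [mul_mul_prod_eq_prod_ite ha ha]
  rw [integral_finset_prod_eval Q fun q u =>
    (if q = a then ψ u else 1) * (if q = a then ψ u else 1) * e u, ← Finset.mul_prod_erase Q _ ha,
    ← Finset.card_erase_of_mem ha]
  congr 1
  · simp [← sq]
  · exact Finset.prod_eq_pow_card fun q hq => by simp [(Finset.mem_erase.1 hq).1]

lemma integrable_sq_sum_mul_prod (he : Integrable e μ) (hψe : Integrable (fun u => ψ u * e u) μ)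
    (hψψe : Integrable (fun u => ψ u ^ 2 * e u) μ) (Q : Finset ι) :
    Integrable (fun z : ι → X => (∑ q ∈ Q, ψ (z q)) ^ 2 * ∏ q ∈ Q, e (z q))
      (Measure.pi fun _ => μ) := by
  simp only [sq_sum_mul_eq_sum_sum]
  exact integrable_finsetSum _ fun a ha => integrable_finsetSum _ fun b hb =>
    integrable_mul_mul_prod he hψe hψψe ha hb

lemma integral_sq_sum_mul_prod (he : Integrable e μ) (hψe : Integrable (fun u => ψ u * e u) μ)
    (hψψe : Integrable (fun u => ψ u ^ 2 * e u) μ) (h₀ : ∫ u, ψ u * e u ∂μ = 0) (Q : Finset ι) :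
    ∫ z : ι → X, (∑ q ∈ Q, ψ (z q)) ^ 2 * ∏ q ∈ Q, e (z q) ∂Measure.pi (fun _ => μ) =
      Q.card * ((∫ u, ψ u ^ 2 * e u ∂μ) * (∫ u, e u ∂μ) ^ (Q.card - 1)) := by
  have hint {a b : ι} (ha : a ∈ Q) (hb : b ∈ Q) :=
    integrable_mul_mul_prod he hψe hψψe ha hb
  simp only [sq_sum_mul_eq_sum_sum]
  rw [integral_finsetSum _ fun a ha => integrable_finsetSum _ fun b hb => hint ha hb,
    ← nsmul_eq_mul, ← Finset.sum_const]
  refine Finset.sum_congr rfl fun a ha => ?_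
  rw [integral_finsetSum _ fun b hb => hint ha hb, Finset.sum_eq_single_of_mem a ha
    fun b hb hba => integral_mul_mul_prod_eq_zero h₀ ha hb hba.symm, integral_sq_mul_prod ha]

end TiltedSecondMoment

lemma card_mul_variance_le_variance_sum_eval {ψ : X → ℝ} (hψ : MemLp ψ 2 μ) (D : Finset κ)
    (π : κ → ι) :
    D.card * Var[ψ; μ] ≤
      Var[fun z : ι → X => ∑ d ∈ D, ψ (z (π d)); Measure.pi fun _ => μ] := by
  classical
  let multiplicity (a : ι) : ℕ := (D.filter fun d => π d = a).card
  have hsum : (fun z : ι → X => ∑ d ∈ D, ψ (z (π d))) =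
      ∑ a, fun z : ι → X => multiplicity a * ψ (z a) := by
    funext z
    simp_rw [Finset.sum_apply, ← Finset.sum_fiberwise' D π fun a => ψ (z a), Finset.sum_const,
      nsmul_eq_mul, multiplicity]
  calc D.card * Var[ψ; μ] = ∑ a, (multiplicity a : ℝ) * Var[ψ; μ] := by
        rw [Finset.card_eq_sum_card_fiberwise fun d _ => Finset.mem_coe.2 (Finset.mem_univ (π d)),
          Nat.cast_sum, Finset.sum_mul]
    _ ≤ ∑ a, (multiplicity a : ℝ) ^ 2 * Var[ψ; μ] := by
        gcongr with a
        · exact variance_nonneg _ _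
        · exact_mod_cast Nat.le_self_pow two_ne_zero _
    _ = Var[fun z : ι → X => ∑ d ∈ D, ψ (z (π d)); Measure.pi fun _ => μ] := by
        rw [hsum, variance_sum_pi (X := fun a u => (multiplicity a : ℝ) * ψ u)
          fun a => hψ.const_mul _]
        simp_rw [variance_const_mul]

end Product

section Symmetric

lemma integral_eq_zero_of_odd {G : Type*} [AddGroup G] [MeasurableSpace G] [MeasurableNeg G]
    {μ : Measure G} [μ.IsNegInvariant] {φ : G → ℝ} (hφ : ∀ u, φ (-u) = -φ u) :
    ∫ u, φ u ∂μ = 0 := by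
  have h := integral_neg_eq_self φ μ
  simp_rw [hφ, integral_neg] at h
  linarith

lemma integral_mul_eq_zero_of_odd_of_even {G : Type*} [AddGroup G] [MeasurableSpace G]
    [MeasurableNeg G] {μ : Measure G} [μ.IsNegInvariant] {φ e : G → ℝ} (hφ : ∀ u, φ (-u) = -φ u)
    (he : ∀ u, e (-u) = e u) : ∫ u, φ u * e u ∂μ = 0 :=
  integral_eq_zero_of_odd fun u => by rw [hφ, he, neg_mul]

end Symmetric

section Moments

variable {Ω : Type*} [MeasurableSpace Ω] {P : Measure Ω} [IsProbabilityMeasure P] {X : Ω → ℝ}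

lemma mgf_le_exp_mul_slope {s s₀ : ℝ} (hs : 0 ≤ s) (hss₀ : s ≤ s₀) (hs₀ : 0 < s₀)
    (hX : Integrable (fun ω => Real.exp (s₀ * X ω)) P) :
    mgf X P s ≤ Real.exp (s * ((mgf X P s₀ - 1) / s₀)) := by
  have chord (x : ℝ) : Real.exp (s * x) ≤ s / s₀ * Real.exp (s₀ * x) + (1 - s / s₀) := by
    have h := convexOn_exp.2 (Set.mem_univ (s₀ * x)) (Set.mem_univ 0)
      (by positivity : 0 ≤ s / s₀) (sub_nonneg.2 ((div_le_one hs₀).2 hss₀)) (by ring)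
    simpa [← mul_assoc, div_mul_cancel₀ s hs₀.ne'] using h
  calc mgf X P s ≤ ∫ ω, (s / s₀ * Real.exp (s₀ * X ω) + (1 - s / s₀)) ∂P :=
        integral_mono_of_nonneg (.of_forall fun ω => (Real.exp_pos _).le)
          ((hX.const_mul _).add (integrable_const _)) (.of_forall fun ω => chord _)
    _ = s * ((mgf X P s₀ - 1) / s₀) + 1 := by
        rw [integral_add (hX.const_mul _) (integrable_const _), integral_const_mul]
        simp only [integral_const, probReal_univ, one_smul, mgf]
        ring
    _ ≤ _ := Real.add_one_le_exp _

lemma mgf_pow_pred_le_exp {s B : ℝ} (hs : 0 ≤ s) (hX₀ : ∀ ω, 0 ≤ X ω)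
    (hX : Integrable (fun ω => Real.exp (s * X ω)) P) (hB : mgf X P s ≤ Real.exp (s * B)) (N : ℕ) :
    mgf X P s ^ (N - 1) ≤ Real.exp (N * (s * B)) := by
  have hone : 1 ≤ mgf X P s := by
    simpa [mgf] using integral_mono (integrable_const 1) hX fun ω =>
      Real.one_le_exp (mul_nonneg hs (hX₀ ω))
  calc mgf X P s ^ (N - 1) ≤ mgf X P s ^ N := pow_le_pow_right₀ hone (Nat.sub_le _ _)
    _ ≤ Real.exp (s * B) ^ N := by gcongr
    _ = Real.exp (N * (s * B)) := (Real.exp_nat_mul _ _).symm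

end Moments

section Gaussian

variable {v : ℝ≥0}

instance : (gaussianReal 0 v).IsNegInvariant :=
  ⟨by simpa [Measure.neg] using gaussianReal_map_neg (μ := 0) (v := v)⟩

lemma integrable_sq_gaussianReal : Integrable (fun z => z ^ 2) (gaussianReal 0 v) :=
  (memLp_id_gaussianReal 2).integrable_sq

lemma integral_sq_gaussianReal : ∫ z, z ^ 2 ∂gaussianReal 0 v = v := by
  simpa [variance_eq_integral aemeasurable_id'] using variance_fun_id_gaussianReal (μ := 0) (v := v)

/-- The posterior mean of a centred Gaussian location of variance `τ ^ 2` observed with Gaussian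
noise of variance `v` is this multiple of the observation. -/
noncomputable def shrinkage (v : ℝ≥0) (τ : ℝ) : ℝ≥0 := ⟨τ ^ 2 / (v + τ ^ 2), by positivity⟩

lemma coe_shrinkage (v : ℝ≥0) (τ : ℝ) : (shrinkage v τ : ℝ) = τ ^ 2 / (v + τ ^ 2) := rfl

lemma shrinkage_pos (v : ℝ≥0) {τ : ℝ} (hτ : 0 < τ) : 0 < shrinkage v τ :=
  NNReal.coe_pos.1 (by rw [coe_shrinkage]; positivity)

lemma shrinkage_mono (v : ℝ≥0) {τ₀ τ : ℝ} (hτ₀ : 0 < τ₀) (hτ : τ₀ ≤ τ) :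
    shrinkage v τ₀ ≤ shrinkage v τ := by
  have := hτ₀.trans_le hτ
  rw [← NNReal.coe_le_coe, coe_shrinkage, coe_shrinkage, div_le_div_iff₀ (by positivity)
    (by positivity)]
  have : τ₀ ^ 2 ≤ τ ^ 2 := by gcongr
  nlinarith [v.coe_nonneg]

/-- Completing the square. -/
lemma weight_mul_gaussianPDFReal (hv : v ≠ 0) {τ : ℝ} (hτ : 0 < τ) (m u : ℝ) :
    weight τ u * gaussianPDFReal m v u =
      √(shrinkage v τ) * Real.exp (-m ^ 2 / (2 * (v + τ ^ 2))) *
        gaussianPDFReal (shrinkage v τ * m) (shrinkage v τ * v) u := by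
  have : (0 : ℝ) < v := by exact_mod_cast pos_iff_ne_zero.2 hv
  have hr : (0 : ℝ) < shrinkage v τ := by exact_mod_cast shrinkage_pos v hτ
  have normalization : √(shrinkage v τ) * (√(2 * Real.pi * (shrinkage v τ * v)))⁻¹ =
      (√(2 * Real.pi * v))⁻¹ := by
    rw [show 2 * Real.pi * (shrinkage v τ * v) = shrinkage v τ * (2 * Real.pi * v) by ring,
      Real.sqrt_mul hr.le, mul_inv, mul_inv_cancel_left₀ (Real.sqrt_pos.2 hr).ne']
  have exponent : -u ^ 2 / (2 * τ ^ 2) + -(u - m) ^ 2 / (2 * v) =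
      -m ^ 2 / (2 * (v + τ ^ 2)) +
        -(u - shrinkage v τ * m) ^ 2 / (2 * (shrinkage v τ * v)) := by
    rw [coe_shrinkage]
    field_simp
    ring
  rw [gaussianPDFReal, gaussianPDFReal, weight, NNReal.coe_mul, mul_left_comm, ← Real.exp_add,
    exponent, Real.exp_add, ← normalization]
  ring

lemma integral_influence_gaussianReal (hv : v ≠ 0) {τ : ℝ} (hτ : 0 < τ) (m : ℝ) :
    ∫ u, influence τ u ∂gaussianReal m v =
      √(shrinkage v τ) * Real.exp (-m ^ 2 / (2 * (v + τ ^ 2))) * (shrinkage v τ * m) := by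
  have hrv : shrinkage v τ * v ≠ 0 := mul_ne_zero (shrinkage_pos v hτ).ne' hv
  have hdensity (u : ℝ) : gaussianPDFReal m v u • influence τ u =
      √(shrinkage v τ) * Real.exp (-m ^ 2 / (2 * (v + τ ^ 2))) *
        (gaussianPDFReal (shrinkage v τ * m) (shrinkage v τ * v) u • u) := by
    rw [smul_eq_mul, smul_eq_mul, ← mul_assoc, ← weight_mul_gaussianPDFReal hv hτ, influence]
    ring
  simp_rw [integral_gaussianReal_eq_integral_smul hv, hdensity]
  rw [integral_const_mul, ← integral_gaussianReal_eq_integral_smul hrv, integral_id_gaussianReal]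

lemma exists_pos_le_integral_influence_add_one (hv : v ≠ 0) {τ₀ : ℝ} (hτ₀ : 0 < τ₀) :
    ∃ c > 0, ∀ τ ≥ τ₀, c ≤ ∫ z, influence τ (z + 1) ∂gaussianReal 0 v := by
  have hr := shrinkage_pos v hτ₀
  refine ⟨√(shrinkage v τ₀) * Real.exp (-1 / (2 * v)) * shrinkage v τ₀, by positivity,
    fun τ hτ => ?_⟩
  have : (0 : ℝ) < v := by exact_mod_cast pos_iff_ne_zero.2 hv
  have hshift : ∫ z, influence τ (z + 1) ∂gaussianReal 0 v =
      ∫ u, influence τ u ∂gaussianReal 1 v := by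
    rw [← zero_add (1 : ℝ), ← gaussianReal_map_add_const, integral_map (by fun_prop)
      (by fun_prop), zero_add]
  rw [hshift, integral_influence_gaussianReal hv (hτ₀.trans_le hτ), one_pow, mul_one]
  have := NNReal.coe_le_coe.2 (shrinkage_mono v hτ₀ hτ)
  have hexp : Real.exp (-1 / (2 * v)) ≤ Real.exp (-1 / (2 * (v + τ ^ 2))) := by
    rw [Real.exp_le_exp, neg_div, neg_div, neg_le_neg_iff]
    gcongr
    exact le_add_of_nonneg_right (sq_nonneg τ)
  gcongr

lemma exists_pos_le_integral_sq_influence {μ : Measure ℝ} [NullSingletonClass μ] [NeZero μ]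
    (hμ : Integrable (fun z => z ^ 2) μ) {τ₀ : ℝ} (hτ₀ : 0 < τ₀) :
    ∃ c > 0, ∀ τ ≥ τ₀, c ≤ ∫ z, influence τ z ^ 2 ∂μ := by
  have hint (τ : ℝ) : Integrable (fun z => influence τ z ^ 2) μ :=
    hμ.mono' (by fun_prop) (.of_forall fun z => by
      rw [Real.norm_of_nonneg (sq_nonneg _)]; exact sq_influence_le_sq τ z)
  refine ⟨∫ z, influence τ₀ z ^ 2 ∂μ, ?_, fun τ hτ =>
    integral_mono (hint τ₀) (hint τ) fun z => sq_influence_mono hτ₀ hτ z⟩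
  rw [gt_iff_lt, integral_pos_iff_support_of_nonneg (fun z => sq_nonneg _) (hint τ₀)]
  have hsupport : Function.support (fun z => influence τ₀ z ^ 2) = {0}ᶜ := by
    ext z
    simp [influence, (weight_pos τ₀ z).ne']
  rw [hsupport,
    measure_congr (Filter.eventuallyEq_univ.2 (compl_mem_ae_iff.2 (measure_singleton 0)))]
  exact Measure.measure_univ_pos.2 (NeZero.ne μ)

lemma exists_mgf_sq_gaussianReal_le_exp (v : ℝ≥0) :
    ∃ s₀ > 0, Integrable (fun z => Real.exp (s₀ * z ^ 2)) (gaussianReal 0 v) ∧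
      ∃ B, ∀ s, 0 ≤ s → s ≤ s₀ →
        mgf (fun z => z ^ 2) (gaussianReal 0 v) s ≤ Real.exp (s * B) := by
  obtain ⟨s₀, hs₀, hint⟩ := IsGaussian.exists_integrable_exp_sq (gaussianReal 0 v)
  simp only [Real.norm_eq_abs, sq_abs] at hint
  exact ⟨s₀, hs₀, hint, _, fun s hs hss₀ => mgf_le_exp_mul_slope hs hss₀ hs₀ hint⟩

end Gaussian

section FilterMSE

variable {ι κ : Type*} [Fintype ι] {μ : Measure ℝ} {τ : ℝ}

/-- The mean squared error of the filter at a pixel with neighbourhood `D`, when the neighbour `d`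
carries the noise variable `π d`, of law `μ`, and its noise-free value exceeds that of the pixel by
`a d`. -/
noncomputable def filterMSE (μ : Measure ℝ) (τ : ℝ) (D : Finset κ) (π : κ → ι) (a : κ → ℝ) : ℝ≥0∞ :=
  ∫⁻ z : ι → ℝ, ENNReal.ofReal (weightedMean τ D (fun d => z (π d) + a d) ^ 2)
    ∂Measure.pi fun _ => μ

lemma filterMSE_le_of_forall {D : Finset κ} {π : κ → ι} {a : κ → ℝ} {G : (ι → ℝ) → ℝ}
    (hG : Integrable G (Measure.pi fun _ => μ))
    (hle : ∀ z, weightedMean τ D (fun d => z (π d) + a d) ^ 2 ≤ G z) :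
    filterMSE μ τ D π a ≤ ENNReal.ofReal (∫ z, G z ∂Measure.pi fun _ => μ) := by
  rw [ofReal_integral_eq_lintegral_ofReal hG (.of_forall fun z => (sq_nonneg _).trans (hle z))]
  exact lintegral_mono fun z => ENNReal.ofReal_le_ofReal (hle z)

lemma integrable_sq_influence_mul_exp (hμ : Integrable (fun z => z ^ 2) μ) {s : ℝ}
    (hs : s ≤ 1 / τ ^ 2) : Integrable (fun z => influence τ z ^ 2 * Real.exp (s * z ^ 2)) μ :=
  hμ.mono' (by fun_prop) (.of_forall fun z => by
    rw [Real.norm_of_nonneg (by positivity)]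
    exact sq_influence_mul_exp_le_sq hs z)

lemma integrable_influence_mul_exp (hμ : Integrable (fun z => z ^ 2) μ) {s : ℝ}
    (hexp : Integrable (fun z => Real.exp (s * z ^ 2)) μ) (hs : s ≤ 1 / τ ^ 2) :
    Integrable (fun z => influence τ z * Real.exp (s * z ^ 2)) μ := by
  refine ((integrable_sq_influence_mul_exp hμ hs).add hexp).mono' (by fun_prop)
    (.of_forall fun z => ?_)
  rw [norm_mul, Real.norm_of_nonneg (Real.exp_pos _).le, Pi.add_apply, ← add_one_mul]
  gcongr
  rw [Real.norm_eq_abs, ← sq_abs]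
  nlinarith [sq_nonneg (|influence τ z| - 1)]

lemma filterMSE_eq_filterMSE_id_zero [DecidableEq ι] {D : Finset κ} {π : κ → ι} {a : κ → ℝ}
    (hπ : Set.InjOn π D) (ha : ∀ d ∈ D, a d = 0) :
    filterMSE μ τ D π a = filterMSE μ τ (D.image π) id 0 := by
  have hsum (g : ℝ → ℝ) (z : ι → ℝ) :
      ∑ q ∈ D.image π, g (z q) = ∑ d ∈ D, g (z (π d) + a d) := by
    rw [Finset.sum_image hπ]
    exact Finset.sum_congr rfl fun d hd => by rw [ha d hd, add_zero]
  simp only [filterMSE, weightedMean, id, Pi.zero_apply, add_zero, hsum]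

variable [IsProbabilityMeasure μ]

lemma integrable_add_const_sq (hμ : Integrable (fun z => z ^ 2) μ) (c : ℝ) :
    Integrable (fun z => (z + c) ^ 2) μ :=
  (((memLp_two_iff_integrable_sq aestronglyMeasurable_id).2 hμ).add (memLp_const c)).integrable_sq

lemma integral_add_const_sq [μ.IsNegInvariant] (hμ : Integrable (fun z => z ^ 2) μ) (c : ℝ) :
    ∫ z, (z + c) ^ 2 ∂μ = ∫ z, z ^ 2 ∂μ + c ^ 2 := by
  have hid : Integrable (fun z => z) μ :=
    ((memLp_two_iff_integrable_sq aestronglyMeasurable_id).2 hμ).integrable one_le_two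
  have hlinear : Integrable (fun z => 2 * z * c) μ := (hid.const_mul 2).mul_const c
  have hcentred : ∫ z, z ∂μ = 0 := integral_eq_zero_of_odd fun _ => rfl
  simp_rw [add_sq]
  rw [integral_add (f := fun z => z ^ 2 + 2 * z * c) (hμ.add hlinear) (integrable_const _),
    integral_add hμ hlinear, integral_mul_const, integral_const_mul, hcentred]
  simp

lemma filterMSE_le_of_abs_le_one [μ.IsNegInvariant] (hμ : Integrable (fun z => z ^ 2) μ)
    {D : Finset κ} (π : κ → ι) {a : κ → ℝ} (ha : ∀ d, |a d| ≤ 1) :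
    filterMSE μ τ D π a ≤ ENNReal.ofReal (∫ z, z ^ 2 ∂μ + 1) := by
  have hint (d : κ) : Integrable (fun z : ι → ℝ => (z (π d) + a d) ^ 2) (Measure.pi fun _ => μ) :=
    integrable_comp_eval (μ := fun _ => μ) (integrable_add_const_sq hμ (a d))
  refine (filterMSE_le_of_forall ((integrable_finsetSum D fun d _ => hint d).div_const _)
    fun z => sq_weightedMean_le_mean_sq τ D _).trans (ENNReal.ofReal_le_ofReal ?_)
  rw [integral_div, integral_finsetSum _ fun d _ => hint d]
  refine div_le_of_le_mul₀ (Nat.cast_nonneg _) (by positivity) ?_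
  rw [mul_comm, ← nsmul_eq_mul]
  refine Finset.sum_le_card_nsmul _ _ _ fun d _ => ?_
  rw [integral_comp_eval (μ := fun _ => μ) (f := fun u => (u + a d) ^ 2) (by fun_prop),
    integral_add_const_sq hμ (a d)]
  gcongr
  exact (sq_le_one_iff_abs_le_one _).2 (ha d)

/-- Bounding the weights by their geometric mean costs a factor `∏ d, exp (s * z d ^ 2)`, with
`s = 1 / (τ ^ 2 * |D|)`; being a product, it factors over the independent noise variables. -/
lemma filterMSE_id_zero_le [μ.IsNegInvariant] {s₀ B : ℝ} (hμ : Integrable (fun z => z ^ 2) μ)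
    (hint : Integrable (fun z => Real.exp (s₀ * z ^ 2)) μ)
    (hB : ∀ s, 0 ≤ s → s ≤ s₀ → mgf (fun z => z ^ 2) μ s ≤ Real.exp (s * B))
    {D : Finset ι} (hD : 1 / (τ ^ 2 * D.card) ≤ s₀) :
    filterMSE μ τ D id 0 ≤
      ENNReal.ofReal ((∫ z, z ^ 2 ∂μ) * Real.exp (B / τ ^ 2) / D.card) := by
  rcases D.eq_empty_or_nonempty with rfl | hDne
  · simp [filterMSE, weightedMean]
  have hcard : (1 : ℝ) ≤ D.card := by exact_mod_cast hDne.card_pos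
  set s := 1 / (τ ^ 2 * D.card) with hs
  have hs_nonneg : 0 ≤ s := by positivity
  have hsτ : s ≤ 1 / τ ^ 2 := by
    rw [hs, ← div_div]
    exact div_le_self (by positivity) hcard
  have he := integrable_exp_mul_of_nonneg_of_le hint hs_nonneg hD
  have hψψe := integrable_sq_influence_mul_exp hμ hsτ
  have hψe := integrable_influence_mul_exp hμ he hsτ
  have h₀ : ∫ u, influence τ u * Real.exp (s * u ^ 2) ∂μ = 0 :=
    integral_mul_eq_zero_of_odd_of_even (influence_neg τ) fun u => by rw [neg_sq]
  have hsecond : ∫ u, influence τ u ^ 2 * Real.exp (s * u ^ 2) ∂μ ≤ ∫ u, u ^ 2 ∂μ :=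
    integral_mono hψψe hμ (sq_influence_mul_exp_le_sq hsτ)
  have hmgf : (∫ u, Real.exp (s * u ^ 2) ∂μ) ^ (D.card - 1) ≤ Real.exp (B / τ ^ 2) := by
    have hexponent : D.card * (s * B) = B / τ ^ 2 := by
      rw [hs]
      field_simp
    rw [← hexponent]
    exact mgf_pow_pred_le_exp hs_nonneg (fun u => sq_nonneg u) he (hB s hs_nonneg hD) D.card
  have hbound := filterMSE_le_of_forall (π := id) (a := 0)
    ((integrable_sq_sum_mul_prod he hψe hψψe D).div_const ((D.card : ℝ) ^ 2)) fun z => by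
      simpa only [id, Pi.zero_apply, add_zero] using
        sq_weightedMean_le_sq_sum_influence_mul_prod_exp τ D z
  refine hbound.trans (ENNReal.ofReal_le_ofReal ?_)
  rw [integral_div, integral_sq_sum_mul_prod he hψe hψψe h₀]
  calc _ ≤ D.card * ((∫ u, u ^ 2 ∂μ) * Real.exp (B / τ ^ 2)) / (D.card : ℝ) ^ 2 := by
        gcongr
    _ = _ := by
        field_simp

lemma filterMSE_le_div_card [μ.IsNegInvariant] {s₀ B : ℝ} (hμ : Integrable (fun z => z ^ 2) μ)
    (hint : Integrable (fun z => Real.exp (s₀ * z ^ 2)) μ)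
    (hB : ∀ s, 0 ≤ s → s ≤ s₀ → mgf (fun z => z ^ 2) μ s ≤ Real.exp (s * B))
    {D : Finset κ} {π : κ → ι} {a : κ → ℝ} (hD : 1 / (τ ^ 2 * D.card) ≤ s₀)
    (hπ : Set.InjOn π D) (ha : ∀ d ∈ D, a d = 0) :
    filterMSE μ τ D π a ≤
      ENNReal.ofReal ((∫ z, z ^ 2 ∂μ) * Real.exp (B / τ ^ 2) / D.card) := by
  classical
  rw [← Finset.card_image_of_injOn hπ] at hD ⊢
  rw [filterMSE_eq_filterMSE_id_zero hπ ha]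
  exact filterMSE_id_zero_le hμ hint hB hD

lemma memLp_influence_add (hτ : 0 < τ) (c : ℝ) : MemLp (fun z => influence τ (z + c)) 2 μ :=
  .of_bound (by fun_prop) τ (.of_forall fun z => abs_influence_le hτ _)

lemma memLp_sum_influence (hτ : 0 < τ) (D : Finset κ) (π : κ → ι) (a : κ → ℝ) :
    MemLp (fun z : ι → ℝ => ∑ d ∈ D, influence τ (z (π d) + a d)) 2 (Measure.pi fun _ => μ) :=
  memLp_finsetSum _ fun d _ => (memLp_influence_add hτ (a d)).comp_measurePreserving
    (measurePreserving_eval (fun _ => μ) (π d))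

lemma ofReal_mean_sq_sum_influence_le_filterMSE (hτ : 0 < τ) (D : Finset κ) (π : κ → ι)
    (a : κ → ℝ) :
    ENNReal.ofReal ((∫ z : ι → ℝ, (∑ d ∈ D, influence τ (z (π d) + a d)) ^ 2
      ∂Measure.pi fun _ => μ) / (D.card : ℝ) ^ 2) ≤ filterMSE μ τ D π a := by
  rw [← integral_div, ofReal_integral_eq_lintegral_ofReal
    ((memLp_sum_influence hτ D π a).integrable_sq.div_const _) (.of_forall fun z => by positivity)]
  exact lintegral_mono fun z =>
    ENNReal.ofReal_le_ofReal (sq_mean_influence_le_sq_weightedMean τ D _)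

lemma ofReal_variance_influence_div_card_le_filterMSE (hτ : 0 < τ) (D : Finset κ) (π : κ → ι) :
    ENNReal.ofReal (Var[influence τ; μ] / D.card) ≤ filterMSE μ τ D π 0 := by
  refine le_trans (ENNReal.ofReal_le_ofReal ?_)
    (ofReal_mean_sq_sum_influence_le_filterMSE hτ D π 0)
  simp only [Pi.zero_apply, add_zero]
  have hψ : MemLp (influence τ) 2 μ := by simpa using memLp_influence_add (μ := μ) hτ 0
  have hS : MemLp (fun z : ι → ℝ => ∑ d ∈ D, influence τ (z (π d))) 2 (Measure.pi fun _ => μ) := by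
    simpa using memLp_sum_influence hτ D π 0
  calc Var[influence τ; μ] / D.card = D.card * Var[influence τ; μ] / (D.card : ℝ) ^ 2 := by
        rcases eq_or_ne (D.card : ℝ) 0 with h | h
        · simp [h]
        · field_simp
    _ ≤ _ := by
        gcongr
        exact (card_mul_variance_le_variance_sum_eval hψ D π).trans
          (variance_le_expectation_sq (hS.aestronglyMeasurable))

lemma ofReal_sq_mean_integral_influence_le_filterMSE (hτ : 0 < τ) (D : Finset κ) (π : κ → ι)
    (a : κ → ℝ) :
    ENNReal.ofReal (((∑ d ∈ D, ∫ z, influence τ (z + a d) ∂μ) / D.card) ^ 2) ≤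
      filterMSE μ τ D π a := by
  refine le_trans (ENNReal.ofReal_le_ofReal ?_)
    (ofReal_mean_sq_sum_influence_le_filterMSE hτ D π a)
  have hS := memLp_sum_influence (μ := μ) hτ D π a
  have hmean : ∫ z : ι → ℝ, ∑ d ∈ D, influence τ (z (π d) + a d) ∂Measure.pi (fun _ => μ) =
      ∑ d ∈ D, ∫ z, influence τ (z + a d) ∂μ := by
    rw [integral_finsetSum _ fun d _ => integrable_comp_eval (μ := fun _ => μ)
      ((memLp_influence_add hτ (a d)).integrable one_le_two)]
    exact Finset.sum_congr rfl fun d _ => integral_comp_eval (μ := fun _ => μ)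
      (f := fun u => influence τ (u + a d)) (by fun_prop)
  have hvar := variance_nonneg (fun z : ι → ℝ => ∑ d ∈ D, influence τ (z (π d) + a d))
    (Measure.pi fun _ => μ)
  rw [variance_eq_sub hS, hmean] at hvar
  rw [div_pow]
  gcongr
  simpa using hvar

end FilterMSE

section PixelMean

variable {n : ℕ} {p : Fin n × Fin n}

lemma measurableSet_pixel (p : Fin n × Fin n) : MeasurableSet (pixel n p) :=
  measurableSet_Ico.prod measurableSet_Ico

lemma volume_pixel (p : Fin n × Fin n) :
    volume (pixel n p) = ENNReal.ofReal (1 / n) * ENNReal.ofReal (1 / n) := by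
  have hside (a : ℝ) : (a + 1) / n - a / n = 1 / n := by ring
  rw [pixel, Measure.volume_eq_prod, Measure.prod_prod, Real.volume_Ico, Real.volume_Ico, hside,
    hside]

lemma volume_pixel_ne_zero (p : Fin n × Fin n) : volume (pixel n p) ≠ 0 := by
  simp [volume_pixel, p.1.pos]

lemma volume_pixel_ne_top (p : Fin n × Fin n) : volume (pixel n p) ≠ ∞ := by
  rw [volume_pixel]
  finiteness

lemma pixelMean_eq_of_forall {f : ℝ × ℝ → ℝ} {c : ℝ} (h : ∀ t ∈ pixel n p, f t = c) :
    pixelMean n f p = c := by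
  rw [pixelMean, setAverage_congr_fun (measurableSet_pixel p) (.of_forall h),
    setAverage_const (volume_pixel_ne_zero p) (volume_pixel_ne_top p)]

lemma pixelMean_mem_of_convex {s : Set ℝ} (hs : Convex ℝ s) (hs' : IsClosed s) (h₀ : (0 : ℝ) ∈ s)
    {f : ℝ × ℝ → ℝ} (hf : ∀ t, f t ∈ s) (p : Fin n × Fin n) : pixelMean n f p ∈ s := by
  by_cases hint : IntegrableOn f (pixel n p)
  · exact hs.set_average_mem hs' (volume_pixel_ne_zero p) (volume_pixel_ne_top p)
      (.of_forall hf) hint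
  · rwa [pixelMean, setAverage_eq, integral_undef hint, smul_zero]

lemma horizonImage_mem_Icc (h : ℝ → ℝ) (t : ℝ × ℝ) : horizonImage h t ∈ Set.Icc (0 : ℝ) 1 :=
  ⟨Set.indicator_nonneg (fun _ _ => zero_le_one) t,
    Set.indicator_le_self' (fun _ _ => zero_le_one) t⟩

lemma abs_pixelMean_sub_pixelMean_le_one (h : ℝ → ℝ) (p q : Fin n × Fin n) :
    |pixelMean n (horizonImage h) q - pixelMean n (horizonImage h) p| ≤ 1 := by
  have hmem := pixelMean_mem_of_convex (n := n) (convex_Icc 0 1) isClosed_Icc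
    (Set.left_mem_Icc.2 zero_le_one) (horizonImage_mem_Icc h)
  simpa using abs_sub_le_of_le_of_le (hmem q).1 (hmem q).2 (hmem p).1 (hmem p).2

lemma pixelMean_horizonImage_eq_zero {h : ℝ → ℝ} (H : ∀ t ∈ pixel n p, h t.1 ≤ t.2) :
    pixelMean n (horizonImage h) p = 0 :=
  pixelMean_eq_of_forall fun t ht => Set.indicator_of_notMem (by simpa using H t ht) _

lemma pixelMean_horizonImage_eq_one {h : ℝ → ℝ} (H : ∀ t ∈ pixel n p, t.2 < h t.1) :
    pixelMean n (horizonImage h) p = 1 :=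
  pixelMean_eq_of_forall fun t ht => Set.indicator_of_mem (by simpa using H t ht) _

/-- The image below the horizontal line at height `J / n`, which is constant on every pixel. -/
noncomputable def flatImage (n J : ℕ) : ℝ × ℝ → ℝ := horizonImage fun _ => (J : ℝ) / n

lemma pixelMean_flatImage (J : ℕ) (p : Fin n × Fin n) :
    pixelMean n (flatImage n J) p = if (p.2 : ℕ) < J then 1 else 0 := by
  split_ifs with hp
  · refine pixelMean_horizonImage_eq_one fun t ht => ht.2.2.trans_le ?_
    gcongr
    exact_mod_cast hp
  · refine pixelMean_horizonImage_eq_zero fun t ht => le_trans ?_ ht.2.1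
    gcongr
    exact not_lt.1 hp

end PixelMean

section Risk

variable {n : ℕ}

/-- The pixel at displacement `d` from `p`, coordinates being read modulo `n`. -/
def neighbour (p : Fin n × Fin n) (d : ℤ × ℤ) : Fin n × Fin n := (shift p.1 d.1, shift p.2 d.2)

lemma window_nonempty (b : Boundary) (Δ : ℕ) (p : Fin n × Fin n) : (window b Δ p).Nonempty :=
  ⟨(0, 0), by cases b <;> simp [window]⟩

lemma semiOracleYF_sub_eq_weightedMean (b : Boundary) (Δ : ℕ) (τ : ℝ) (x y : Fin n × Fin n → ℝ)
    (p : Fin n × Fin n) :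
    semiOracleYF b Δ τ x y p - x p =
      weightedMean τ (window b Δ p) fun d => y (neighbour p d) - x p := by
  have hweight : 0 < ∑ d ∈ window b Δ p, weight τ (y (neighbour p d) - x p) :=
    Finset.sum_pos (fun d _ => weight_pos τ _) (window_nonempty b Δ p)
  have hfilter : semiOracleYF b Δ τ x y p =
      (∑ d ∈ window b Δ p, weight τ (y (neighbour p d) - x p) * y (neighbour p d)) /
        ∑ d ∈ window b Δ p, weight τ (y (neighbour p d) - x p) := rfl
  rw [hfilter, weightedMean]
  simp only [influence, mul_sub, Finset.sum_sub_distrib, ← Finset.sum_mul]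
  rw [sub_div, mul_div_cancel_left₀ _ hweight.ne']

/-- The mean squared error, at the pixel `p`, of the semi-oracle filter applied to the noise-free
pixel values `x` and noise of variance `σ ^ 2`. -/
noncomputable def pixelRisk (σ : ℝ≥0) (b : Boundary) (Δ : ℕ) (τ : ℝ) (x : Fin n × Fin n → ℝ)
    (p : Fin n × Fin n) : ℝ≥0∞ :=
  filterMSE (gaussianReal 0 (σ ^ 2)) τ (window b Δ p) (neighbour p)
    fun d => x (neighbour p d) - x p

variable {σ : ℝ≥0} {b : Boundary} {Δ : ℕ} {τ : ℝ} {f : ℝ × ℝ → ℝ}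

lemma risk_semiOracleYF_eq_sum_pixelRisk :
    risk n σ f (semiOracleYF b Δ τ (pixelMean n f)) =
      ENNReal.ofReal (1 / (n : ℝ) ^ 2) * ∑ p, pixelRisk σ b Δ τ (pixelMean n f) p := by
  have herror (z : Fin n × Fin n → ℝ) (p : Fin n × Fin n) :
      (pixelMean n f p - semiOracleYF b Δ τ (pixelMean n f) (pixelMean n f + z) p) ^ 2 =
        weightedMean τ (window b Δ p) (fun d => z (neighbour p d) +
          (pixelMean n f (neighbour p d) - pixelMean n f p)) ^ 2 := by
    rw [sub_sq_comm, semiOracleYF_sub_eq_weightedMean]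
    simp only [Pi.add_apply, add_sub_assoc, add_sub_left_comm]
  have hmeas (p : Fin n × Fin n) : Measurable fun z : Fin n × Fin n → ℝ => ENNReal.ofReal
      (weightedMean τ (window b Δ p) (fun d => z (neighbour p d) +
        (pixelMean n f (neighbour p d) - pixelMean n f p)) ^ 2) :=
    ((continuous_weightedMean τ _ fun d => by fun_prop).pow 2).measurable.ennreal_ofReal
  simp_rw [risk, herror, ENNReal.ofReal_mul (show (0 : ℝ) ≤ 1 / (n : ℝ) ^ 2 by positivity),
    ENNReal.ofReal_sum_of_nonneg fun _ _ => sq_nonneg _]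
  rw [lintegral_const_mul _ (Finset.measurable_fun_sum _ fun p _ => hmeas p),
    lintegral_finsetSum _ fun p _ => hmeas p]
  rfl

lemma ofReal_le_risk_of_le_pixelRisk {S : Finset (Fin n × Fin n)} {c : ℝ}
    (h : ∀ p ∈ S, ENNReal.ofReal c ≤ pixelRisk σ b Δ τ (pixelMean n f) p) :
    ENNReal.ofReal (S.card * c / (n : ℝ) ^ 2) ≤
      risk n σ f (semiOracleYF b Δ τ (pixelMean n f)) := by
  rw [risk_semiOracleYF_eq_sum_pixelRisk, div_eq_inv_mul, ← one_div,
    ENNReal.ofReal_mul (by positivity), ENNReal.ofReal_mul (Nat.cast_nonneg _),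
    ENNReal.ofReal_natCast, ← nsmul_eq_mul S.card]
  gcongr
  exact (Finset.card_nsmul_le_sum _ _ _ h).trans (Finset.sum_le_sum_of_subset S.subset_univ)

lemma risk_le_ofReal_of_pixelRisk_le {S : Finset (Fin n × Fin n)} {v K : ℝ} (hv : 0 ≤ v)
    (hK : 0 ≤ K) (hS : ∀ p ∉ S, pixelRisk σ b Δ τ (pixelMean n f) p ≤ ENNReal.ofReal v)
    (h : ∀ p, pixelRisk σ b Δ τ (pixelMean n f) p ≤ ENNReal.ofReal K) :
    risk n σ f (semiOracleYF b Δ τ (pixelMean n f)) ≤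
      ENNReal.ofReal (v + S.card * K / (n : ℝ) ^ 2) := by
  classical
  have hpixel (p : Fin n × Fin n) : pixelRisk σ b Δ τ (pixelMean n f) p ≤
      ENNReal.ofReal (v + if p ∈ S then K else 0) := by
    split_ifs with hp
    · exact (h p).trans (ENNReal.ofReal_le_ofReal (le_add_of_nonneg_left hv))
    · simpa using hS p hp
  have hsum : ∑ p : Fin n × Fin n, (v + if p ∈ S then K else 0) = n ^ 2 * v + S.card * K := by
    simp [Finset.sum_add_distrib, Finset.sum_ite_mem, sq]
  calc risk n σ f (semiOracleYF b Δ τ (pixelMean n f))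
      ≤ ENNReal.ofReal (1 / (n : ℝ) ^ 2) *
          ∑ p : Fin n × Fin n, ENNReal.ofReal (v + if p ∈ S then K else 0) := by
        rw [risk_semiOracleYF_eq_sum_pixelRisk]
        gcongr with p
        exact hpixel p
    _ = ENNReal.ofReal (1 / (n : ℝ) ^ 2 * (n ^ 2 * v + S.card * K)) := by
        rw [← ENNReal.ofReal_sum_of_nonneg fun p _ => by split_ifs <;> positivity, hsum,
          ← ENNReal.ofReal_mul (by positivity)]
    _ ≤ _ := by
        refine ENNReal.ofReal_le_ofReal ?_
        rw [mul_add, one_div_mul_eq_div, one_div_mul_eq_div]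
        gcongr
        exact div_le_of_le_mul₀ (by positivity) hv (mul_comm _ _).le

end Risk

section Windows

variable {n : ℕ} {b : Boundary} {Δ : ℕ}

lemma coe_shift {i : Fin n} {d : ℤ} (h₀ : 0 ≤ (i : ℤ) + d) (h₁ : (i : ℤ) + d < n) :
    ((shift i d : Fin n) : ℤ) = i + d := by
  have hval : ((shift i d : Fin n) : ℕ) = (((i : ℤ) + d) % n).toNat := rfl
  rw [hval, Int.emod_eq_of_lt h₀ h₁, Int.toNat_of_nonneg h₀]

/-- The displacements from the coordinate `i` that stay in a `Δ`-neighbourhood: the window of a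
pixel is the product of the `rows` of its two coordinates. -/
noncomputable def rows (b : Boundary) (Δ : ℕ) (i : Fin n) : Finset ℤ :=
  match b with
  | .periodic => Finset.Icc (-(Δ : ℤ)) Δ
  | .truncated => (Finset.Icc (-(Δ : ℤ)) Δ).filter fun d => 0 ≤ (i : ℤ) + d ∧ (i : ℤ) + d < n

lemma window_eq_product (b : Boundary) (Δ : ℕ) (p : Fin n × Fin n) :
    window b Δ p = rows b Δ p.1 ×ˢ rows b Δ p.2 := by
  cases b
  · rfl
  · exact Finset.filter_product (fun d => 0 ≤ (p.1 : ℤ) + d ∧ (p.1 : ℤ) + d < n)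
      fun d => 0 ≤ (p.2 : ℤ) + d ∧ (p.2 : ℤ) + d < n

lemma card_rows_le (b : Boundary) (Δ : ℕ) (i : Fin n) : (rows b Δ i).card ≤ 2 * Δ + 1 := by
  have hcard : (Finset.Icc (-(Δ : ℤ)) Δ).card = 2 * Δ + 1 := by
    rw [Int.card_Icc]
    lia
  cases b
  · exact hcard.le
  · exact (Finset.card_filter_le _ _).trans hcard.le

lemma card_rows_truncated_le (Δ : ℕ) (i : Fin n) : (rows .truncated Δ i).card ≤ n := by
  have hsub : rows .truncated Δ i ⊆ Finset.Ico (-(i : ℤ)) (n - i) := fun d hd => by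
    simp only [rows, Finset.mem_filter] at hd
    rw [Finset.mem_Ico]
    lia
  refine (Finset.card_le_card hsub).trans ?_
  rw [Int.card_Ico]
  lia

lemma card_window_le (b : Boundary) (Δ : ℕ) (p : Fin n × Fin n) :
    (window b Δ p).card ≤ (2 * Δ + 1) ^ 2 := by
  rw [window_eq_product, Finset.card_product, sq]
  exact Nat.mul_le_mul (card_rows_le b Δ p.1) (card_rows_le b Δ p.2)

lemma mem_rows_of_mem {i : Fin n} {d : ℤ} (hd : -(Δ : ℤ) ≤ d) (hd' : d ≤ Δ)
    (h₀ : 0 ≤ (i : ℤ) + d) (h₁ : (i : ℤ) + d < n) : d ∈ rows b Δ i := by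
  cases b <;> simp [rows, *]

/-- The displacements from the coordinate `j` in a `Δ`-neighbourhood that lead below the
level `J`. -/
noncomputable def rowsBelow (b : Boundary) (Δ J : ℕ) (j : Fin n) : Finset ℤ :=
  (rows b Δ j).filter fun d => (shift j d : ℕ) < J

lemma sub_max_le_card_rowsBelow (b : Boundary) {J : ℕ} {j : Fin n} (hj : J ≤ j) :
    (J : ℤ) - max 0 (j - Δ) ≤ (rowsBelow b Δ J j).card := by
  have hsub : Finset.Ico (max (-(j : ℤ)) (-Δ)) (J - j) ⊆ rowsBelow b Δ J j := fun d hd => by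
    rw [Finset.mem_Ico, max_le_iff] at hd
    have hshift := coe_shift (i := j) (d := d) (by lia) (by lia)
    exact Finset.mem_filter.2
      ⟨mem_rows_of_mem (by lia) (by lia) (by lia) (by lia), by omega⟩
  have hcard := Finset.card_le_card hsub
  rw [Int.card_Ico] at hcard
  lia

lemma mul_le_card_rowsBelow_periodic {J : ℕ} {j : Fin n} (hn : n ≤ Δ) (hj : J ≤ j) :
    (Δ / n + 1) * J ≤ (rowsBelow .periodic Δ J j).card := by
  let disp (a : ℕ × ℕ) : ℤ := ((a.1 * n + a.2 : ℕ) : ℤ) - j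
  have hshift {k r : ℕ} (hr : r < J) : (shift j (disp (k, r)) : ℕ) = r := by
    have hval : (shift j (disp (k, r)) : ℕ) = (((j : ℤ) + disp (k, r)) % n).toNat := rfl
    rw [hval, add_sub_cancel, ← Int.natCast_mod, Int.toNat_natCast, Nat.mul_add_mod_self_right,
      Nat.mod_eq_of_lt (by lia)]
  have hmaps : ∀ a ∈ Finset.range (Δ / n + 1) ×ˢ Finset.range J,
      disp a ∈ rowsBelow .periodic Δ J j := by
    rintro ⟨k, r⟩ ha
    obtain ⟨hk, hr⟩ : k < Δ / n + 1 ∧ r < J := by simpa using ha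
    have hkΔ : k * n ≤ Δ := (Nat.le_div_iff_mul_le j.pos).1 (Nat.le_of_lt_succ hk)
    refine Finset.mem_filter.2 ⟨?_, (hshift hr).trans_lt hr⟩
    simp only [rows, Finset.mem_Icc, disp]
    lia
  have hinj : Set.InjOn disp (Finset.range (Δ / n + 1) ×ˢ Finset.range J : Finset (ℕ × ℕ)) := by
    rintro ⟨k, r⟩ ha ⟨k', r'⟩ ha' h
    obtain ⟨hr, hr'⟩ : r < J ∧ r' < J :=
      ⟨by simpa using (Finset.mem_product.1 ha).2, by simpa using (Finset.mem_product.1 ha').2⟩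
    obtain rfl : r = r' := by rw [← hshift (k := k) hr, h, hshift hr']
    simpa [disp, j.pos.ne'] using h
  simpa using Finset.card_le_card_of_injOn disp hmaps hinj

lemma card_rows_le_mul_card_rowsBelow (b : Boundary) {J : ℕ} {j : Fin n} (hΔ : 1 ≤ Δ)
    (hJ : n ≤ 3 * J) (hj : J ≤ j) (hjΔ : 2 * (j - J) ≤ Δ) :
    (rows b Δ j).card ≤ 9 * (rowsBelow b Δ J j).card := by
  have hrows := card_rows_le b Δ j
  have hbelow := sub_max_le_card_rowsBelow (Δ := Δ) b hj
  have hn : (rows b Δ j).card ≤ 2 * n ∨ b = .periodic ∧ n ≤ Δ := by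
    cases b with
    | truncated => have := card_rows_truncated_le Δ j; lia
    | periodic => lia
  obtain hn | ⟨rfl, hn⟩ := hn
  · lia
  · have hperiods := mul_le_card_rowsBelow_periodic hn hj
    have hΔn : Δ < (Δ / n + 1) * n := Nat.lt_mul_of_div_lt (Nat.lt_succ_self _) j.pos
    have hJn := Nat.mul_le_mul_left (Δ / n + 1) hJ
    lia

lemma card_window_le_mul_card_filter (b : Boundary) {J : ℕ} {p : Fin n × Fin n} (hΔ : 1 ≤ Δ)
    (hJ : n ≤ 3 * J) (hp : J ≤ p.2) (hpΔ : 2 * (p.2 - J) ≤ Δ) :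
    (window b Δ p).card ≤
      9 * ((window b Δ p).filter fun d => ((neighbour p d).2 : ℕ) < J).card := by
  have hfilter : (window b Δ p).filter (fun d => ((neighbour p d).2 : ℕ) < J) =
      rows b Δ p.1 ×ˢ rowsBelow b Δ J p.2 := by
    rw [window_eq_product]
    exact Finset.filter_product_right fun d => (shift p.2 d : ℕ) < J
  rw [hfilter, window_eq_product, Finset.card_product, Finset.card_product, mul_left_comm]
  exact Nat.mul_le_mul_left _ (card_rows_le_mul_card_rowsBelow b hΔ hJ hp hpΔ)

end Windows

section LowerBounds

variable {n : ℕ} {σ : ℝ≥0} {τ c : ℝ}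

lemma ofReal_div_sq_le_risk_flatImage_zero (b : Boundary) (Δ : ℕ) (hn : 0 < n) (hτ : 0 < τ)
    (hc : 0 ≤ c) (hvar : c ≤ ∫ z, influence τ z ^ 2 ∂gaussianReal 0 (σ ^ 2)) :
    ENNReal.ofReal (c / (2 * Δ + 1) ^ 2) ≤
      risk n σ (flatImage n 0) (semiOracleYF b Δ τ (pixelMean n (flatImage n 0))) := by
  have hpixel (p : Fin n × Fin n) : ENNReal.ofReal (c / (2 * Δ + 1) ^ 2) ≤
      pixelRisk σ b Δ τ (pixelMean n (flatImage n 0)) p := by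
    have hcard : ((window b Δ p).card : ℝ) ≤ (2 * Δ + 1) ^ 2 := by
      exact_mod_cast card_window_le b Δ p
    have hpos : (0 : ℝ) < (window b Δ p).card := by
      exact_mod_cast (window_nonempty b Δ p).card_pos
    have hVar : c ≤ Var[influence τ; gaussianReal 0 (σ ^ 2)] := by
      rwa [variance_of_integral_eq_zero (continuous_influence τ).aemeasurable
        (integral_eq_zero_of_odd (influence_neg τ))]
    calc ENNReal.ofReal (c / (2 * Δ + 1) ^ 2)
        ≤ ENNReal.ofReal (Var[influence τ; gaussianReal 0 (σ ^ 2)] / (window b Δ p).card) := by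
          gcongr
          exact hc.trans hVar
      _ ≤ filterMSE (gaussianReal 0 (σ ^ 2)) τ (window b Δ p) (neighbour p) 0 :=
          ofReal_variance_influence_div_card_le_filterMSE hτ _ _
      _ = _ := by
          simp only [pixelRisk, pixelMean_flatImage, Nat.not_lt_zero, if_false, sub_zero]
          rfl
  have hrisk := ofReal_le_risk_of_le_pixelRisk (S := Finset.univ) fun p _ => hpixel p
  convert hrisk using 2
  simp only [Finset.card_univ, Fintype.card_prod, Fintype.card_fin, Nat.cast_mul]
  field_simp

lemma ofReal_sq_le_pixelRisk_flatImage (b : Boundary) {Δ J : ℕ} (hτ : 0 < τ) (hc : 0 ≤ c)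
    (hbias : c ≤ ∫ z, influence τ (z + 1) ∂gaussianReal 0 (σ ^ 2)) (hΔ : 1 ≤ Δ) (hJ : n ≤ 3 * J)
    {p : Fin n × Fin n} (hp : J ≤ p.2) (hpΔ : 2 * (p.2 - J) ≤ Δ) :
    ENNReal.ofReal ((c / 9) ^ 2) ≤ pixelRisk σ b Δ τ (pixelMean n (flatImage n J)) p := by
  let below : Finset (ℤ × ℤ) := (window b Δ p).filter fun d => ((neighbour p d).2 : ℕ) < J
  have hcard : ((window b Δ p).card : ℝ) ≤ 9 * below.card := by
    exact_mod_cast card_window_le_mul_card_filter b hΔ hJ hp hpΔ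
  have hpos : (0 : ℝ) < (window b Δ p).card := by
    exact_mod_cast (window_nonempty b Δ p).card_pos
  have hmean (d : ℤ × ℤ) : ∫ z, influence τ (z + (pixelMean n (flatImage n J) (neighbour p d) -
      pixelMean n (flatImage n J) p)) ∂gaussianReal 0 (σ ^ 2) =
        if ((neighbour p d).2 : ℕ) < J then ∫ z, influence τ (z + 1) ∂gaussianReal 0 (σ ^ 2)
        else 0 := by
    rw [pixelMean_flatImage, pixelMean_flatImage, if_neg (not_lt.2 hp)]
    split_ifs
    · simp only [sub_zero]
    · simpa only [sub_zero, add_zero] using integral_eq_zero_of_odd (influence_neg τ)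
  refine le_trans ?_ (ofReal_sq_mean_integral_influence_le_filterMSE hτ _ _ _)
  simp only [hmean, ← Finset.sum_filter, Finset.sum_const, nsmul_eq_mul]
  gcongr ENNReal.ofReal (?_ ^ 2)
  rw [div_le_div_iff₀ (by norm_num) hpos]
  calc c * (window b Δ p).card ≤ c * (9 * below.card) := by gcongr
    _ = below.card * c * 9 := by ring
    _ ≤ _ := by gcongr

lemma ofReal_mul_sq_div_le_risk_flatImage (b : Boundary) {Δ J D : ℕ} (hτ : 0 < τ) (hc : 0 ≤ c)
    (hbias : c ≤ ∫ z, influence τ (z + 1) ∂gaussianReal 0 (σ ^ 2)) (hΔ : 1 ≤ Δ) (hJ : n ≤ 3 * J)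
    (hDΔ : 2 * (D - 1) ≤ Δ) (hD : J + D ≤ n) :
    ENNReal.ofReal (D * (c / 9) ^ 2 / n) ≤
      risk n σ (flatImage n J) (semiOracleYF b Δ τ (pixelMean n (flatImage n J))) := by
  let S : Finset (Fin n × Fin n) :=
    Finset.univ ×ˢ (Finset.Ico J (J + D)).attachFin fun a ha => by grind
  have hScard : S.card = n * D := by simp [S]
  have hrisk := ofReal_le_risk_of_le_pixelRisk (σ := σ) (b := b) (Δ := Δ) (τ := τ)
    (f := flatImage n J) (S := S) (c := (c / 9) ^ 2) fun p hp => by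
      obtain ⟨hJp, hpD⟩ : J ≤ p.2 ∧ p.2 < J + D := by simpa [S] using hp
      exact ofReal_sq_le_pixelRisk_flatImage b hτ hc hbias hΔ hJ hJp (by lia)
  refine le_of_eq_of_le ?_ hrisk
  obtain rfl | hn := n.eq_zero_or_pos
  · simp
  · rw [hScard, Nat.cast_mul, sq (n : ℝ), mul_assoc, mul_div_mul_left _ _ (by positivity)]

end LowerBounds

/-- `h` satisfies a one-sided Lipschitz condition, that is, it never falls, or never rises, at a
slope greater than `L`. The horizons in Hölder¹(1) have it with `L = 1`, for either reading of the
integer part. -/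
def OneSidedLipschitz (L : ℝ) (h : ℝ → ℝ) : Prop :=
  Monotone (fun t => h t + L * t) ∨ Antitone fun t => h t - L * t

lemma OneSidedLipschitz.mono {L L' : ℝ} {h : ℝ → ℝ} (hh : OneSidedLipschitz L h) (hL : L ≤ L') :
    OneSidedLipschitz L' h :=
  hh.imp
    (fun hm t t' htt' => by
      have := hm htt'
      dsimp only at this ⊢
      nlinarith)
    fun ha t t' htt' => by
      have := ha htt'
      dsimp only at this ⊢
      nlinarith

lemma oneSidedLipschitz_of_abs_sub_le {L : ℝ} {h : ℝ → ℝ}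
    (hh : ∀ t t', |h t - h t'| ≤ L * |t - t'|) : OneSidedLipschitz L h :=
  .inl fun t t' htt' => by
    have hle := (abs_le.1 (hh t t')).2
    rw [abs_of_nonpos (sub_nonpos.2 htt')] at hle
    dsimp only
    linarith

lemma oneSidedLipschitz_of_deriv_sub_le {h : ℝ → ℝ} (hd : Differentiable ℝ h)
    (hosc : ∀ t t', deriv h t - deriv h t' ≤ 1) : OneSidedLipschitz 1 h := by
  by_cases hneg : ∀ t, -1 ≤ deriv h t
  · refine .inl (monotone_of_deriv_nonneg (by fun_prop) fun t => ?_)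
    rw [deriv_fun_add (hd t) (by fun_prop), deriv_const_mul_field, deriv_id'']
    linarith [hneg t]
  · obtain ⟨t₀, ht₀⟩ := not_forall.1 hneg
    refine .inr (antitone_of_deriv_nonpos (by fun_prop) fun t => ?_)
    rw [deriv_fun_sub (hd t) (by fun_prop), deriv_const_mul_field, deriv_id'']
    linarith [hosc t t₀]

lemma IsHolder.oneSidedLipschitz {ip : IntegerPart} {h : ℝ → ℝ} (hh : IsHolder ip 1 1 h) :
    OneSidedLipschitz 1 h := by
  obtain ⟨hd, hh⟩ := hh
  cases ip with
  | strict =>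
    have hk : IntegerPart.strict.eval 1 = 0 := by simp [IntegerPart.eval]
    refine oneSidedLipschitz_of_abs_sub_le fun t t' => ?_
    simpa [hk] using hh t t'
  | floor =>
    have hk : IntegerPart.floor.eval 1 = 1 := by simp [IntegerPart.eval]
    rw [hk] at hh hd
    refine oneSidedLipschitz_of_deriv_sub_le (by simpa using hd 0 zero_lt_one) fun t t' => ?_
    exact (le_abs_self _).trans (by simpa using hh t t')

lemma isHolder_const (ip : IntegerPart) (α : ℝ) {C : ℝ} (hC : 0 ≤ C) (c : ℝ) :
    IsHolder ip α C fun _ => c := by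
  refine ⟨fun m _ => ?_, fun t t' => ?_⟩
  · exact contDiff_const.differentiable_iteratedDeriv' m
  · simp only [iteratedDeriv_const, sub_self, abs_zero]
    positivity

lemma horizonImage_const_mem_horizonClass (ip : IntegerPart) (α : ℝ) {C : ℝ} (hC : 0 ≤ C)
    (c : ℝ) : horizonImage (fun _ => c) ∈ horizonClass ip α C :=
  ⟨_, isHolder_const ip α hC c, isHolder_const ip 1 zero_le_one c, rfl⟩

lemma card_le_mul_of_key {α : Type*} {S : Finset α} (key x : α → ℕ) {K W : ℕ}
    (hkey : ∀ p ∈ S, key p < K)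
    (hinj : ∀ p ∈ S, ∀ q ∈ S, key p = key q → x p = x q → p = q)
    (hdiam : ∀ p ∈ S, ∀ q ∈ S, key p = key q → x q < x p + W) : S.card ≤ W * K := by
  classical
  have himage : (S.image key).card ≤ K := by
    rw [← Finset.card_range K]
    exact Finset.card_le_card (Finset.image_subset_iff.2 fun p hp => Finset.mem_range.2 (hkey p hp))
  refine (Finset.card_le_mul_card_image S W fun k hk => ?_).trans (Nat.mul_le_mul_left W himage)
  obtain ⟨p, hp, hmin⟩ := Finset.exists_min_image (S.filter fun p => key p = k) x
    (by simpa [Finset.filter_nonempty_iff] using hk)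
  have hmaps : ∀ q ∈ S.filter fun p => key p = k, x q ∈ Finset.Ico (x p) (x p + W) := by
    grind
  have hinjOn : Set.InjOn x (S.filter fun p => key p = k) := by
    intro q hq r hr hqr
    grind
  simpa using Finset.card_le_card_of_injOn x hmaps hinjOn

section Blocks

variable {n : ℕ} {Δ : ℕ} {p q : Fin n × Fin n}

/-- A closed square covering the pixels whose coordinates differ from those of `p` by at
most `Δ`. -/
def block (Δ : ℕ) (p : Fin n × Fin n) : Set (ℝ × ℝ) :=
  Set.Icc (((p.1 : ℝ) - Δ) / n) ((p.1 + Δ + 1) / n) ×ˢ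
    Set.Icc (((p.2 : ℝ) - Δ) / n) ((p.2 + Δ + 1) / n)

lemma mem_block_iff {t : ℝ × ℝ} :
    t ∈ block Δ p ↔ ((p.1 : ℝ) - Δ ≤ t.1 * n ∧ t.1 * n ≤ p.1 + Δ + 1) ∧
      (p.2 : ℝ) - Δ ≤ t.2 * n ∧ t.2 * n ≤ p.2 + Δ + 1 := by
  have hn : (0 : ℝ) < n := by exact_mod_cast p.1.pos
  simp only [block, Set.mem_prod, Set.mem_Icc, div_le_iff₀ hn, le_div_iff₀ hn]

/-- The horizon `h` crosses the `Δ`-neighbourhood of the pixel `p`. -/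
def Crosses (h : ℝ → ℝ) (Δ : ℕ) (p : Fin n × Fin n) : Prop :=
  (∃ t ∈ block Δ p, t.2 < h t.1) ∧ ∃ t ∈ block Δ p, h t.1 ≤ t.2

lemma reflect_mem_block {t : ℝ × ℝ} (ht : t ∈ block Δ p) :
    (1 - t.1, t.2) ∈ block Δ (p.1.rev, p.2) := by
  have hrev : ((p.1.rev : ℕ) : ℝ) = n - (p.1 + 1) := by
    rw [Fin.val_rev, Nat.cast_sub p.1.2, Nat.cast_succ]
  rw [mem_block_iff] at ht ⊢
  simp only [hrev, sub_mul, one_mul]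
  exact ⟨⟨by linarith, by linarith⟩, ht.2⟩

lemma Crosses.reflect {h : ℝ → ℝ} (hp : Crosses h Δ p) :
    Crosses (fun t => h (1 - t)) Δ (p.1.rev, p.2) := by
  obtain ⟨⟨s, hs, hbelow⟩, t, ht, habove⟩ := hp
  exact ⟨⟨_, reflect_mem_block hs, by simpa using hbelow⟩,
    _, reflect_mem_block ht, by simpa using habove⟩

/-- The line of slope `-(L + 1)` through two crossed blocks meets the graph of `h` only once,
since `h` never falls faster than at slope `-L`. -/
lemma fst_lt_of_crosses_of_monotone {h : ℝ → ℝ} {L : ℕ} (hm : Monotone fun t => h t + L * t)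
    (hp : Crosses h Δ p) (hq : Crosses h Δ q)
    (hkey : (p.2 : ℕ) + (L + 1) * p.1 = q.2 + (L + 1) * q.1) :
    (q.1 : ℕ) < p.1 + (L + 1) * (2 * Δ + 1) := by
  by_contra! hfar
  obtain ⟨⟨s, hs, hbelow⟩, -⟩ := hp
  obtain ⟨-, t, ht, habove⟩ := hq
  have hn : (0 : ℝ) < n := by exact_mod_cast p.1.pos
  have hL : (0 : ℝ) ≤ L := L.cast_nonneg
  have hΔ : (0 : ℝ) ≤ Δ := Δ.cast_nonneg
  have hfar : (p.1 : ℝ) + (L + 1) * (2 * Δ + 1) ≤ q.1 := by exact_mod_cast hfar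
  have hkey : (p.2 : ℝ) + (L + 1) * p.1 = q.2 + (L + 1) * q.1 := by exact_mod_cast hkey
  rw [mem_block_iff] at hs ht
  have hst : s.1 ≤ t.1 := le_of_mul_le_mul_right (by nlinarith) hn
  have hrise : s.2 + L * s.1 < t.2 + L * t.1 := by
    have : h s.1 + L * s.1 ≤ h t.1 + L * t.1 := hm hst
    linarith
  have hrise := mul_lt_mul_of_pos_right hrise hn
  nlinarith

lemma card_crosses_le_of_monotone {h : ℝ → ℝ} {L : ℕ} (hm : Monotone fun t => h t + L * t)
    {S : Finset (Fin n × Fin n)} (hS : ∀ p ∈ S, Crosses h Δ p) :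
    S.card ≤ (L + 1) * (2 * Δ + 1) * ((L + 2) * n) := by
  refine card_le_mul_of_key (fun p => p.2 + (L + 1) * p.1) (fun p => p.1) (fun p _ => ?_)
    (fun p _ q _ hkey hfst => ?_)
    fun p hp q hq hkey => fst_lt_of_crosses_of_monotone hm (hS p hp) (hS q hq) hkey
  · nlinarith [p.1.2, p.2.2]
  · rw [hfst, Nat.add_right_cancel_iff] at hkey
    exact Prod.ext (Fin.ext hfst) (Fin.ext hkey)

lemma card_crosses_le {h : ℝ → ℝ} {L : ℕ} (hh : OneSidedLipschitz L h)
    {S : Finset (Fin n × Fin n)} (hS : ∀ p ∈ S, Crosses h Δ p) :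
    S.card ≤ (L + 1) * (2 * Δ + 1) * ((L + 2) * n) := by
  obtain hm | ha := hh
  · exact card_crosses_le_of_monotone hm hS
  · have hm : Monotone fun t => h (1 - t) + L * t := fun t t' htt' => by
      have : h (1 - t) - L * (1 - t) ≤ h (1 - t') - L * (1 - t') := ha (by linarith)
      dsimp only
      linarith
    let reflect : Fin n × Fin n ↪ Fin n × Fin n := Fin.revPerm.toEmbedding.prodMap (.refl _)
    rw [← Finset.card_map reflect]
    refine card_crosses_le_of_monotone hm fun p hp => ?_
    obtain ⟨q, hq, rfl⟩ := Finset.mem_map.1 hp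
    exact (hS q hq).reflect

end Blocks

section Interior

variable {n : ℕ} {b : Boundary} {Δ : ℕ} {p : Fin n × Fin n} {d : ℤ × ℤ}

/-- The `Δ`-neighbourhood of the pixel `p` stays inside the image. -/
def Interior (Δ : ℕ) (p : Fin n × Fin n) : Prop :=
  (Δ ≤ p.1 ∧ (p.1 : ℕ) + Δ < n) ∧ Δ ≤ p.2 ∧ (p.2 : ℕ) + Δ < n

lemma card_filter_near_boundary_le (n Δ : ℕ) :
    (Finset.univ.filter fun i : Fin n => ¬(Δ ≤ i ∧ (i : ℕ) + Δ < n)).card ≤ 2 * Δ := by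
  have hmaps : ∀ i ∈ Finset.univ.filter fun i : Fin n => ¬(Δ ≤ i ∧ (i : ℕ) + Δ < n),
      (i : ℕ) ∈ Finset.range Δ ∪ Finset.Ico (n - Δ) n := fun i hi => by
    simp only [Finset.mem_filter, Finset.mem_univ, true_and] at hi
    simp only [Finset.mem_union, Finset.mem_range, Finset.mem_Ico]
    lia
  refine (Finset.card_le_card_of_injOn _ hmaps Fin.val_injective.injOn).trans
    ((Finset.card_union_le _ _).trans ?_)
  rw [Finset.card_range, Nat.card_Ico]
  lia

lemma card_not_interior_le {S : Finset (Fin n × Fin n)} (hS : ∀ p ∈ S, ¬Interior Δ p) :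
    S.card ≤ 4 * Δ * n := by
  let A : Finset (Fin n) := Finset.univ.filter fun i => ¬(Δ ≤ i ∧ (i : ℕ) + Δ < n)
  have hA : A.card ≤ 2 * Δ := card_filter_near_boundary_le n Δ
  have hsub : S ⊆ A ×ˢ Finset.univ ∪ Finset.univ ×ˢ A := fun p hp => by
    simpa [A, Interior, -not_and, not_and_or] using hS p hp
  calc S.card ≤ (A ×ˢ Finset.univ).card + (Finset.univ ×ˢ A).card :=
        (Finset.card_le_card hsub).trans (Finset.card_union_le _ _)
    _ = 2 * A.card * n := by
        rw [Finset.card_product, Finset.card_product, Finset.card_univ, Fintype.card_fin]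
        ring
    _ ≤ 2 * (2 * Δ) * n := by gcongr
    _ = 4 * Δ * n := by ring

lemma rows_eq_Icc {i : Fin n} (h₀ : Δ ≤ i) (h₁ : (i : ℕ) + Δ < n) :
    rows b Δ i = Finset.Icc (-(Δ : ℤ)) Δ := by
  cases b
  · rfl
  · refine Finset.filter_true_of_mem fun d hd => ?_
    rw [Finset.mem_Icc] at hd
    lia

lemma Interior.window_eq (hp : Interior Δ p) :
    window b Δ p = Finset.Icc (-(Δ : ℤ)) Δ ×ˢ Finset.Icc (-(Δ : ℤ)) Δ := by
  rw [window_eq_product, rows_eq_Icc hp.1.1 hp.1.2, rows_eq_Icc hp.2.1 hp.2.2]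

lemma Interior.card_window (hp : Interior Δ p) : (window b Δ p).card = (2 * Δ + 1) ^ 2 := by
  rw [hp.window_eq, Finset.card_product, Int.card_Icc, sq]
  congr 1 <;> lia

lemma Interior.coe_neighbour (hp : Interior Δ p) (hd : d ∈ window b Δ p) :
    ((neighbour p d).1 : ℤ) = p.1 + d.1 ∧ ((neighbour p d).2 : ℤ) = p.2 + d.2 := by
  rw [hp.window_eq, Finset.mem_product, Finset.mem_Icc, Finset.mem_Icc] at hd
  obtain ⟨⟨hlo₁, hhi₁⟩, hlo₂, hhi₂⟩ := hp
  exact ⟨coe_shift (by lia) (by lia), coe_shift (by lia) (by lia)⟩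

lemma Interior.injOn_neighbour (hp : Interior Δ p) : Set.InjOn (neighbour p) (window b Δ p) := by
  intro d hd e he hde
  have hcoe := hp.coe_neighbour hd
  rw [hde, (hp.coe_neighbour he).1, (hp.coe_neighbour he).2] at hcoe
  exact Prod.ext (by lia) (by lia)

lemma pixel_subset_block {q : Fin n × Fin n} (h₁ : |(q.1 : ℝ) - p.1| ≤ Δ)
    (h₂ : |(q.2 : ℝ) - p.2| ≤ Δ) : pixel n q ⊆ block Δ p := by
  rw [abs_le] at h₁ h₂
  refine Set.prod_mono (Set.Ico_subset_Icc_self.trans (Set.Icc_subset_Icc ?_ ?_))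
    (Set.Ico_subset_Icc_self.trans (Set.Icc_subset_Icc ?_ ?_))
  all_goals
    gcongr
    linarith

lemma Interior.pixel_neighbour_subset_block (hp : Interior Δ p) (hd : d ∈ window b Δ p) :
    pixel n (neighbour p d) ⊆ block Δ p := by
  obtain ⟨h₁, h₂⟩ := hp.coe_neighbour hd
  rw [hp.window_eq, Finset.mem_product, Finset.mem_Icc, Finset.mem_Icc, ← abs_le, ← abs_le,
    ← sub_eq_iff_eq_add'.2 h₁, ← sub_eq_iff_eq_add'.2 h₂] at hd
  exact pixel_subset_block (by exact_mod_cast hd.1) (by exact_mod_cast hd.2)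

lemma Interior.pixelMean_neighbour {h : ℝ → ℝ} (hp : Interior Δ p) (hh : ¬Crosses h Δ p)
    (hd : d ∈ window b Δ p) :
    pixelMean n (horizonImage h) (neighbour p d) = pixelMean n (horizonImage h) p := by
  have hself : pixel n p ⊆ block Δ p := pixel_subset_block (by simp) (by simp)
  have hneighbour := hp.pixel_neighbour_subset_block hd
  rw [Crosses, not_and_or] at hh
  push Not at hh
  obtain habove | hbelow := hh
  · rw [pixelMean_horizonImage_eq_zero fun t ht => habove t (hneighbour ht),
      pixelMean_horizonImage_eq_zero fun t ht => habove t (hself ht)]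
  · rw [pixelMean_horizonImage_eq_one fun t ht => hbelow t (hneighbour ht),
      pixelMean_horizonImage_eq_one fun t ht => hbelow t (hself ht)]

end Interior

section UpperBound

variable {n : ℕ} {σ : ℝ≥0} {τ : ℝ}

lemma pixelRisk_horizonImage_le (b : Boundary) (Δ : ℕ) (h : ℝ → ℝ) (p : Fin n × Fin n) :
    pixelRisk σ b Δ τ (pixelMean n (horizonImage h)) p ≤ ENNReal.ofReal ((σ : ℝ) ^ 2 + 1) := by
  have hle := filterMSE_le_of_abs_le_one (τ := τ) (D := window b Δ p)
    (integrable_sq_gaussianReal (v := σ ^ 2)) (neighbour p)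
    fun d => abs_pixelMean_sub_pixelMean_le_one h p (neighbour p d)
  rwa [integral_sq_gaussianReal, NNReal.coe_pow] at hle

lemma exists_pixelRisk_le_of_not_crosses (σ : ℝ≥0) (hτ : 0 < τ) :
    ∃ A ≥ 0, ∃ Δ₀ : ℕ, ∀ (b : Boundary) (n Δ : ℕ), Δ₀ ≤ Δ → ∀ (h : ℝ → ℝ) (p : Fin n × Fin n),
      Interior Δ p → ¬Crosses h Δ p →
        pixelRisk σ b Δ τ (pixelMean n (horizonImage h)) p ≤
          ENNReal.ofReal (A / (2 * Δ + 1) ^ 2) := by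
  obtain ⟨s₀, hs₀, hint, B, hB⟩ := exists_mgf_sq_gaussianReal_le_exp (σ ^ 2)
  obtain ⟨Δ₀, hΔ₀⟩ := exists_nat_ge (1 / (τ ^ 2 * s₀))
  refine ⟨(σ : ℝ) ^ 2 * Real.exp (B / τ ^ 2), by positivity, Δ₀,
    fun b n Δ hΔ h p hp hcross => ?_⟩
  have hcard : ((window b Δ p).card : ℝ) = (2 * Δ + 1) ^ 2 := by
    exact_mod_cast hp.card_window
  have hlarge : 1 / (τ ^ 2 * (window b Δ p).card) ≤ s₀ := by
    have hΔ' : 1 / (τ ^ 2 * s₀) ≤ (2 * Δ + 1) ^ 2 :=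
      hΔ₀.trans (by nlinarith [show (Δ₀ : ℝ) ≤ Δ from mod_cast hΔ, Δ.cast_nonneg (α := ℝ)])
    rw [hcard, div_le_iff₀ (by positivity)]
    rw [div_le_iff₀ (by positivity)] at hΔ'
    linarith
  have hle := filterMSE_le_div_card integrable_sq_gaussianReal hint hB hlarge hp.injOn_neighbour
    fun d hd => sub_eq_zero.2 (hp.pixelMean_neighbour hcross hd)
  rwa [integral_sq_gaussianReal, NNReal.coe_pow, hcard] at hle

lemma card_not_interior_or_crosses_le {Δ : ℕ} {h : ℝ → ℝ} {L : ℕ} (hh : OneSidedLipschitz L h)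
    (hΔ : 1 ≤ Δ) {S : Finset (Fin n × Fin n)} (hS : ∀ p ∈ S, Interior Δ p → Crosses h Δ p) :
    S.card ≤ (4 + 3 * (L + 1) * (L + 2)) * (Δ * n) := by
  classical
  rw [← Finset.card_filter_add_card_filter_not (s := S) (p := Interior Δ)]
  have hcross : (S.filter fun p => Interior Δ p).card ≤ (L + 1) * (2 * Δ + 1) * ((L + 2) * n) :=
    card_crosses_le hh fun p hp => hS p (Finset.mem_filter.1 hp).1 (Finset.mem_filter.1 hp).2
  have hboundary : (S.filter fun p => ¬Interior Δ p).card ≤ 4 * Δ * n :=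
    card_not_interior_le fun p hp => (Finset.mem_filter.1 hp).2
  calc _ ≤ (L + 1) * (2 * Δ + 1) * ((L + 2) * n) + 4 * Δ * n := add_le_add hcross hboundary
    _ ≤ (L + 1) * (3 * Δ) * ((L + 2) * n) + 4 * Δ * n := by gcongr; lia
    _ = _ := by ring

lemma exists_risk_horizonImage_le (σ : ℝ≥0) (hτ : 0 < τ) (L : ℝ) :
    ∃ K > 0, ∃ Δ₀ : ℕ, ∀ (b : Boundary) (n Δ : ℕ), Δ₀ ≤ Δ → ∀ h, OneSidedLipschitz L h →
      risk n σ (horizonImage h) (semiOracleYF b Δ τ (pixelMean n (horizonImage h))) ≤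
        ENNReal.ofReal (K * (1 / Δ ^ 2 + Δ / n)) := by
  classical
  obtain ⟨A, hA, Δ₀, hpixel⟩ := exists_pixelRisk_le_of_not_crosses σ hτ
  obtain ⟨L', hL'⟩ := exists_nat_ge L
  let M : ℕ := 4 + 3 * (L' + 1) * (L' + 2)
  refine ⟨A + M * (σ ^ 2 + 1), by positivity, max 1 Δ₀, fun b n Δ hΔ h hh => ?_⟩
  have hΔ1 : 1 ≤ Δ := (le_max_left _ _).trans hΔ
  let S : Finset (Fin n × Fin n) := Finset.univ.filter fun p => Interior Δ p → Crosses h Δ p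
  have hS : (S.card : ℝ) ≤ M * (Δ * n) := by
    exact_mod_cast card_not_interior_or_crosses_le (hh.mono hL') hΔ1 fun p hp =>
      (Finset.mem_filter.1 hp).2
  have hrisk := risk_le_ofReal_of_pixelRisk_le (σ := σ) (S := S) (v := A / (2 * Δ + 1) ^ 2)
    (by positivity) (by positivity) (fun p hp => ?_) (pixelRisk_horizonImage_le (τ := τ) b Δ h)
  · refine hrisk.trans (ENNReal.ofReal_le_ofReal ?_)
    calc A / (2 * Δ + 1) ^ 2 + S.card * (σ ^ 2 + 1) / n ^ 2
        ≤ A / Δ ^ 2 + M * (Δ * n) * (σ ^ 2 + 1) / n ^ 2 := by gcongr; linarith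
      _ = A * (1 / Δ ^ 2) + M * (σ ^ 2 + 1) * (Δ / n) := by field_simp
      _ ≤ (A + M * (σ ^ 2 + 1)) * (1 / Δ ^ 2) + (A + M * (σ ^ 2 + 1)) * (Δ / n) := by
        gcongr
        · exact le_add_of_nonneg_right (by positivity)
        · exact le_add_of_nonneg_left hA
      _ = _ := (mul_add _ _ _).symm
  · obtain ⟨hp₁, hp₂⟩ : Interior Δ p ∧ ¬Crosses h Δ p := by simpa [S] using hp
    exact hpixel b n Δ ((le_max_right _ _).trans hΔ) h p hp₁ hp₂

end UpperBound

section Rate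

variable {σ : ℝ≥0}

lemma ofReal_mul_sq_div_le_risk_flatImage_half {n Δ : ℕ} {τ c u : ℝ} (b : Boundary) (hτ : 0 < τ)
    (hc : 0 ≤ c) (hbias : c ≤ ∫ z, influence τ (z + 1) ∂gaussianReal 0 (σ ^ 2)) (hu : 2 ≤ u)
    (hun : 2 * u ≤ n) (huΔ : u ≤ Δ) :
    ENNReal.ofReal (u / 2 * (c / 9) ^ 2 / n) ≤
      risk n σ (flatImage n (n / 2)) (semiOracleYF b Δ τ (pixelMean n (flatImage n (n / 2)))) := by
  have hceil : (⌈u / 2⌉₊ : ℝ) < u / 2 + 1 := Nat.ceil_lt_add_one (by positivity)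
  have hΔ : 2 ≤ Δ := by exact_mod_cast hu.trans huΔ
  have hn : 4 ≤ n := by exact_mod_cast (by linarith : (4 : ℝ) ≤ n)
  have hDΔ : 2 * ⌈u / 2⌉₊ < Δ + 2 := by
    exact_mod_cast (by linarith : 2 * (⌈u / 2⌉₊ : ℝ) < Δ + 2)
  have hDn : 2 * ⌈u / 2⌉₊ ≤ n := by exact_mod_cast (by linarith : 2 * (⌈u / 2⌉₊ : ℝ) ≤ n)
  refine le_trans ?_ (ofReal_mul_sq_div_le_risk_flatImage (D := ⌈u / 2⌉₊) b hτ hc hbias (by lia)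
    (by lia) (by lia) (by lia))
  gcongr
  exact Nat.le_ceil _

lemma exists_pos_ofReal_div_sq_le_risk_flatImage (hσ : 0 < σ) {τ₀ : ℝ} (hτ₀ : 0 < τ₀) :
    ∃ c > 0, ∀ τ ≥ τ₀, ∀ (b : Boundary) (n Δ : ℕ) (u : ℝ), 2 ≤ u → u ^ 3 = n →
      ∃ J, ENNReal.ofReal (c / u ^ 2) ≤
        risk n σ (flatImage n J) (semiOracleYF b Δ τ (pixelMean n (flatImage n J))) := by
  have hv : σ ^ 2 ≠ 0 := pow_ne_zero 2 hσ.ne'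
  have := nullSingletonClass_gaussianReal (μ := 0) hv
  obtain ⟨c, hc, hvar⟩ := exists_pos_le_integral_sq_influence
    (integrable_sq_gaussianReal (v := σ ^ 2)) hτ₀
  obtain ⟨m, hm, hbias⟩ := exists_pos_le_integral_influence_add_one hv hτ₀
  refine ⟨min (c / 9) ((m / 9) ^ 2 / 2), by positivity, fun τ hτ b n Δ u hu hun => ?_⟩
  have hτ' : 0 < τ := hτ₀.trans_le hτ
  have hn : 0 < n := by exact_mod_cast (by rw [← hun]; positivity : (0 : ℝ) < n)
  obtain hΔ | hΔ := lt_or_ge (Δ : ℝ) u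
  · refine ⟨0, (ENNReal.ofReal_le_ofReal ?_).trans
      (ofReal_div_sq_le_risk_flatImage_zero b Δ hn hτ' hc.le (hvar τ hτ))⟩
    calc min (c / 9) ((m / 9) ^ 2 / 2) / u ^ 2 ≤ c / 9 / u ^ 2 := by
          gcongr; exact min_le_left _ _
      _ = c / (3 * u) ^ 2 := by field_simp; norm_num
      _ ≤ c / (2 * Δ + 1) ^ 2 := by gcongr; linarith
  · refine ⟨n / 2, (ENNReal.ofReal_le_ofReal ?_).trans
      (ofReal_mul_sq_div_le_risk_flatImage_half b hτ' hm.le (hbias τ hτ) hu ?_ hΔ)⟩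
    · calc min (c / 9) ((m / 9) ^ 2 / 2) / u ^ 2 ≤ (m / 9) ^ 2 / 2 / u ^ 2 := by
            gcongr; exact min_le_right _ _
        _ = u / 2 * (m / 9) ^ 2 / n := by rw [← hun]; field_simp
    · rw [← hun, pow_succ]
      gcongr
      nlinarith

lemma exists_risk_horizonImage_le_div_sq (σ : ℝ≥0) {τ : ℝ} (hτ : 0 < τ) (L : ℝ) :
    ∃ K > 0, ∃ u₀, ∀ (b : Boundary) (n : ℕ) (u : ℝ), u₀ ≤ u → u ^ 3 = n →
      ∃ Δ : ℕ, ∀ h, OneSidedLipschitz L h →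
        risk n σ (horizonImage h) (semiOracleYF b Δ τ (pixelMean n (horizonImage h))) ≤
          ENNReal.ofReal (K / u ^ 2) := by
  obtain ⟨K, hK, Δ₀, hrisk⟩ := exists_risk_horizonImage_le σ hτ L
  refine ⟨3 * K, by positivity, max 1 Δ₀, fun b n u hu hun => ⟨⌈u⌉₊, fun h hh => ?_⟩⟩
  have hu1 : 1 ≤ u := (le_max_left _ _).trans hu
  have hle : u ≤ ⌈u⌉₊ := Nat.le_ceil u
  have hlt : (⌈u⌉₊ : ℝ) < u + 1 := Nat.ceil_lt_add_one (by positivity)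
  have hΔ : Δ₀ ≤ ⌈u⌉₊ := by exact_mod_cast ((le_max_right _ _).trans hu).trans hle
  refine (hrisk b n _ hΔ h hh).trans (ENNReal.ofReal_le_ofReal ?_)
  calc K * (1 / ⌈u⌉₊ ^ 2 + ⌈u⌉₊ / n) ≤ K * (1 / u ^ 2 + 2 * u / n) := by gcongr; linarith
    _ = 3 * K / u ^ 2 := by rw [← hun]; field_simp; norm_num

lemma sameOrder_rpow_neg_two_thirds {f : ℕ → ℝ≥0∞} {c K u₀ : ℝ} (hc : 0 < c) (hK : 0 < K)
    (hf : ∀ (n : ℕ) (u : ℝ), u₀ ≤ u → u ^ 3 = n →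
      ENNReal.ofReal (c / u ^ 2) ≤ f n ∧ f n ≤ ENNReal.ofReal (K / u ^ 2)) :
    SameOrder f fun n => (n : ℝ) ^ (-(2 / 3) : ℝ) := by
  obtain ⟨N, hN⟩ := Filter.eventually_atTop.1 <|
    ((tendsto_rpow_atTop (by norm_num : (0 : ℝ) < 1 / 3)).comp
      tendsto_natCast_atTop_atTop).eventually_ge_atTop u₀
  refine ⟨c, K, hc, hK, N, fun n hn => ?_⟩
  have hcube : ((n : ℝ) ^ (1 / 3 : ℝ)) ^ 3 = n := by
    rw [← Real.rpow_mul_natCast n.cast_nonneg]; norm_num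
  have hrate : (n : ℝ) ^ (-(2 / 3) : ℝ) = (((n : ℝ) ^ (1 / 3 : ℝ)) ^ 2)⁻¹ := by
    rw [← Real.rpow_mul_natCast n.cast_nonneg, ← Real.rpow_neg n.cast_nonneg]; norm_num
  simp only [hrate, ← div_eq_mul_inv]
  exact hf n _ (hN n hn.le) hcube

end Rate

end HorizonDenoising

open HorizonDenoising in
theorem theorem6_general {σ : ℝ≥0} (hσ : 0 < σ) (b : Boundary) {T : Set ℝ} (hT : T.Nonempty)
    (hT₀ : ∃ τ₀ > 0, ∀ τ ∈ T, τ₀ ≤ τ) {L : ℝ} {F : Set (ℝ × ℝ → ℝ)}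
    (hconst : ∀ c, horizonImage (fun _ => c) ∈ F)
    (hF : ∀ f ∈ F, ∃ h, OneSidedLipschitz L h ∧ f = horizonImage h) :
    SameOrder
      (fun n => ⨅ (τ ∈ T) (Δ : ℕ), ⨆ f ∈ F, risk n σ f (semiOracleYF b Δ τ (pixelMean n f)))
      (fun n => (n : ℝ) ^ (-(2 / 3) : ℝ)) := by
  obtain ⟨τ₀, hτ₀, hT₀⟩ := hT₀
  obtain ⟨τ₁, hτ₁⟩ := hT
  obtain ⟨c, hc, hlower⟩ := exists_pos_ofReal_div_sq_le_risk_flatImage hσ hτ₀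
  obtain ⟨K, hK, u₀, hupper⟩ := exists_risk_horizonImage_le_div_sq σ (hτ₀.trans_le (hT₀ _ hτ₁)) L
  refine sameOrder_rpow_neg_two_thirds (u₀ := max 2 u₀) hc hK fun n u hu hun => ⟨?_, ?_⟩
  · refine le_iInf₂ fun τ hτ => le_iInf fun Δ => ?_
    obtain ⟨J, hJ⟩ := hlower τ (hT₀ τ hτ) b n Δ u ((le_max_left _ _).trans hu) hun
    exact le_iSup₂_of_le _ (hconst _) hJ
  · obtain ⟨Δ, hΔ⟩ := hupper b n u ((le_max_right _ _).trans hu) hun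
    refine iInf₂_le_of_le τ₁ hτ₁ (iInf_le_of_le Δ (iSup₂_le fun f hf => ?_))
    obtain ⟨h, hh, rfl⟩ := hF f hf
    exact hΔ h hh

theorem theorem6 (ip : HorizonDenoising.IntegerPart) (b : HorizonDenoising.Boundary)
    (α C : ℝ) (hα : 0 < α) (hC : 0 < C) (σ : ℝ≥0) (hσ : 0 < σ)
    (T : Set ℝ) (hT : T.Nonempty) (hT₀ : ∃ τ₀ > 0, ∀ τ ∈ T, τ₀ ≤ τ) :
    HorizonDenoising.SameOrder
      (fun n => ⨅ (τ ∈ T) (Δ : ℕ), ⨆ f ∈ HorizonDenoising.horizonClass ip α C,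
        HorizonDenoising.risk n σ f
          (HorizonDenoising.semiOracleYF b Δ τ (HorizonDenoising.pixelMean n f)))
      (fun n => (n : ℝ) ^ (-(2 / 3) : ℝ)) :=
  theorem6_general hσ b hT hT₀ (HorizonDenoising.horizonImage_const_mem_horizonClass ip α hC.le)
    fun _ ⟨h, _, hh, hf⟩ => ⟨h, hh.oneSidedLipschitz, hf⟩
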